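/- **Setting.** Let $(\mathcal S,\mathcal A,T,r,\mu)$ be a Markov decision process with finite state and action spaces and initial distribution $\mu$, and assume that it is recurrent: for every stationary policy $\pi$ the induced transition matrix $T_\pi(s,s')=\sum_a T(s'|s,a)\pi(a|s)$ is irreducible. Let $\tau_\pi$ be the stationary distribution of $T_\pi$ and $\theta_\pi(s,s')=\tau_\pi(s)T_\pi(s,s')$. Fix stationary policies $\pi^*$ (null hypothesis) and $\pi^{\rm adv}$ (alternative), and write $T^*,\theta^*,T^{\rm adv},\theta^{\rm adv}$ accordingly; let $P^*_n,P^{\rm adv}_n$ be the laws of the state sequence $s^n=(s_1,\dots,s_n)$, with $s_1\sim\mu$ in both cases. A test is a sequence of maps $g_n:\mathcal S^n\to\{0,1\}$ ($0$: accept the null hypothesis), with error probabilities $\alpha_n=P^*_n(g_n=1)$ and $\beta_n=P^{\rm adv}_n(g_n=0)$. Put $\theta_{s^n}(s,s')=\frac1{n-1}\sum_{t=1}^{n-1}\mathbb 1\{s_t=s,s_{t+1}=s'\}$. For a distribution $\nu$ on $\mathcal S^2$ with first marginal $\tau_\nu$ and transition matrix $T_\nu(s,s')=\nu(s,s')/\tau_\nu(s)$,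 and $\theta\in\{\theta^*,\theta^{\rm adv}\}$ with transition matrix $T_\theta$, let $$D_K(\nu,\theta)=\sum_s\tau_\nu(s)\sum_{s'}T_\nu(s,s')\log\frac{T_\nu(s,s')}{T_\theta(s,s')}\in[0,\infty],\qquad \log=\log_2,\ \log 0=-\infty,\ 0\log 0=0 .$$ Let $\mathcal M$ be the set of distributions $\nu$ on $\mathcal S^2$ whose two marginals agree. An infimum over the empty set is $+\infty$. For $\eta>0$ call $\pi^{\rm adv}$ *nondegenerate* if one of the following holds: (a) no $\nu\in\mathcal M$ satisfies $D_K(\nu,\theta^*)\le\eta$ and $D_K(\nu,\theta^{\rm adv})<\infty$; (b) some $\nu\in\mathcal M$ satisfies $D_K(\nu,\theta^*)<\eta$ and $D_K(\nu,\theta^{\rm adv})<\infty$, and the directed graph of the transitions $(s,s')$ with $T^*(s,s')>0$ and $T^{\rm adv}(s,s')>0$ is strongly connected. (For instance, every $\pi^{\rm adv}$ with $D_K(\theta^*,\theta^{\rm adv})<\infty$ is nondegenerate.) **Theorem.** Let $\eta>0$, and let $\mathcal F^*$ be the test with $\mathcal F^*(s^n)=0$ if $D_K(\theta_{s^n},\theta^*)<\eta$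 and $\mathcal F^*(s^n)=1$ otherwise. 1. $\mathcal F^*$ is optimal for $\eta$: it satisfies $\limsup_n\frac1n\log\alpha_n\le-\eta$ and, among all tests that satisfy this inequality, it maximizes $-\limsup_n\frac1n\log\beta_n$ simultaneously for all nondegenerate alternatives $\pi^{\rm adv}$. 2. If $\eta<D_K(\nu,\theta^*)<\infty$ for some $\nu\in\mathcal M$, then $\mathcal F^*$ satisfies $\lim_n\frac1n\log\alpha_n=-\eta$. 3. For every nondegenerate alternative $\pi^{\rm adv}$, $\mathcal F^*$ satisfies $$\lim_{n\to\infty}\frac1n\log\beta_n=-\inf_{\nu\in\mathcal M,\ D_K(\nu,\theta^*)<\eta}D_K(\nu,\theta^{\rm adv}).$$ -/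

import Mathlib

open Filter Topology

noncomputable section

/-- A Markov decision process with finite state space `S` and finite action space `A`:
transition kernel, reward function and initial state distribution. -/
structure MDP (S A : Type*) [Fintype S] where
  /-- `trans s a s'` is the probability of moving from `s` to `s'` under the action `a`. -/
  trans : S → A → S → ℝ
  /-- the reward function -/
  reward : S → A → ℝ
  /-- the initial state distribution -/
  init : S → ℝ
  trans_mem : ∀ s a, trans s a ∈ stdSimplex ℝ S
  init_mem : init ∈ stdSimplex ℝ S

/-- A stationary (randomized) policy: `prob s a` is the probability of the action `a` in the
state `s`. -/
structure StationaryPolicy (S A : Type*) [Fintype A] where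
  prob : S → A → ℝ
  prob_mem : ∀ s, prob s ∈ stdSimplex ℝ A

/-- The state transition matrix induced by a stationary policy. -/
def MDP.induced {S A : Type*} [Fintype S] [Fintype A] (M : MDP S A) (π : StationaryPolicy S A) :
    Matrix S S ℝ :=
  Matrix.of fun s s' => ∑ a, M.trans s a s' * π.prob s a

/-- The MDP is recurrent: under every stationary policy the whole state space is one recurrent
class, that is, the induced transition matrix is irreducible. -/
def MDP.IsRecurrent {S A : Type*} [Fintype S] [Fintype A] (M : MDP S A) : Prop :=
  ∀ π : StationaryPolicy S A, (M.induced π).IsIrreducible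

/-- `θ` is the stationary distribution over state transitions of the chain with transition matrix
`T`, i.e. `θ s s' = τ s * T s s'` for a stationary distribution `τ` of `T`. -/
def IsTransitionFreq {S : Type*} [Fintype S] (T : Matrix S S ℝ) (θ : S → S → ℝ) : Prop :=
  ∃ τ ∈ stdSimplex ℝ S, Matrix.vecMul τ T = τ ∧ ∀ s s', θ s s' = τ s * T s s'

/-- The marginal over states of a distribution over state transitions. -/
def stateMarginal {S : Type*} [Fintype S] (ν : S → S → ℝ) (s : S) : ℝ := ∑ s', ν s s'

/-- The transition matrix of a distribution over state transitions. -/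
def condTrans {S : Type*} [Fintype S] (ν : S → S → ℝ) (s s' : S) : ℝ :=
  ν s s' / stateMarginal ν s

/-- The set of shift-invariant probability distributions over state transitions. -/
def ShiftInvariant (S : Type*) [Fintype S] : Set (S → S → ℝ) :=
  {ν | (∀ s s', 0 ≤ ν s s') ∧ ∑ s, ∑ s', ν s s' = 1 ∧ ∀ i, ∑ j, ν i j = ∑ j, ν j i}

open Classical in
/-- The differential divergence `D_K(ν, θ) = ∑ s, τ s ∑ s', T s s' log₂ (T s s' / T' s s')`, where
`τ, T` are the state marginal and the transition matrix of `ν`, and `T'` is the transition matrix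
of `θ`. It is `⊤` if `ν` charges a transition that is impossible under `T'`; the terms with
`τ s = 0` or `T s s' = 0` vanish. -/
def divK {S : Type*} [Fintype S] (ν θ : S → S → ℝ) : EReal :=
  if ∃ s s', 0 < ν s s' ∧ condTrans θ s s' = 0 then ⊤
  else ((∑ s, stateMarginal ν s *
    ∑ s', condTrans ν s s' * Real.logb 2 (condTrans ν s s' / condTrans θ s s') : ℝ) : EReal)

/-- The probability of the state sequence `s` of length `n` for the Markov chain with initial
distribution `p` and transition matrix `T`. -/
def seqProb {S : Type*} (p : S → ℝ) (T : Matrix S S ℝ) : (n : ℕ) → (Fin n → S) → ℝ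
  | 0, _ => 1
  | n + 1, s => p (s 0) * ∏ t : Fin n, T (s t.castSucc) (s t.succ)

/-- The empirical distribution over state transitions of a state sequence of length `n`,
normalized by the number `n - 1` of its transitions. -/
def empTrans {S : Type*} [DecidableEq S] : (n : ℕ) → (Fin n → S) → S → S → ℝ
  | 0, _ => fun _ _ => 0
  | n + 1, s => fun a b =>
      (∑ t : Fin n, if s t.castSucc = a ∧ s t.succ = b then (1 : ℝ) else 0) / n

/-- A (deterministic) test: for every `n` a decision for every state sequence of length `n`;
`false` accepts the null hypothesis, `true` rejects it. -/
abbrev SeqTest (S : Type*) := (n : ℕ) → (Fin n → S) → Bool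

/-- The probability that the test takes the decision `d` at time `n` when the actions are chosen
by the stationary policy `π`. -/
def decisionProb {S A : Type*} [Fintype S] [DecidableEq S] [Fintype A] (M : MDP S A)
    (π : StationaryPolicy S A) (g : SeqTest S) (d : Bool) (n : ℕ) : ℝ :=
  ∑ s : Fin n → S, if g n s = d then seqProb M.init (M.induced π) n s else 0

/-- Type I error probability at time `n`; `π₀` is the policy under the null hypothesis. -/
def typeIError {S A : Type*} [Fintype S] [DecidableEq S] [Fintype A] (M : MDP S A)
    (π₀ : StationaryPolicy S A) (g : SeqTest S) (n : ℕ) : ℝ :=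
  decisionProb M π₀ g true n

/-- Type II error probability at time `n`; `π₁` is the policy under the alternative. -/
def typeIIError {S A : Type*} [Fintype S] [DecidableEq S] [Fintype A] (M : MDP S A)
    (π₁ : StationaryPolicy S A) (g : SeqTest S) (n : ℕ) : ℝ :=
  decisionProb M π₁ g false n

open Classical in
/-- The base-2 logarithm of a nonnegative real, with `log₂ 0 = -∞`. -/
def elog2 (x : ℝ) : EReal := if x ≤ 0 then ⊥ else ((Real.logb 2 x : ℝ) : EReal)

/-- The sequence `(1 / n) log₂ (x n)`. -/
def logRate (x : ℕ → ℝ) (n : ℕ) : EReal := elog2 (x n) / (n : EReal)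

/-- The type I error exponent constraint `limsup (1 / n) log₂ α_n ≤ -η`. -/
def TypeIConstraint {S A : Type*} [Fintype S] [DecidableEq S] [Fintype A] (M : MDP S A)
    (π₀ : StationaryPolicy S A) (η : ℝ) (g : SeqTest S) : Prop :=
  limsup (logRate (typeIError M π₀ g)) atTop ≤ -(η : EReal)

/-- The test `g` is optimal for the threshold `η` against the alternatives in `𝒜`: it satisfies
the type I constraint and, uniformly over all alternatives in `𝒜`, it has the largest type II
rate `-limsup (1 / n) log₂ β_n` among all tests that satisfy this constraint. -/
def IsOptimalTest {S A : Type*} [Fintype S] [DecidableEq S] [Fintype A] (M : MDP S A)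
    (π₀ : StationaryPolicy S A) (𝒜 : Set (StationaryPolicy S A)) (η : ℝ) (g : SeqTest S) : Prop :=
  TypeIConstraint M π₀ η g ∧
    ∀ g' : SeqTest S, TypeIConstraint M π₀ η g' → ∀ π₁ ∈ 𝒜,
      -limsup (logRate (typeIIError M π₁ g')) atTop ≤
        -limsup (logRate (typeIIError M π₁ g)) atTop

open Classical in
/-- The test that accepts the null hypothesis iff `D_K(θ_{sⁿ}, θ₀) < η`, where `θ_{sⁿ}` is the
empirical distribution over state transitions. -/
def divTest {S : Type*} [Fintype S] [DecidableEq S] (θ₀ : S → S → ℝ) (η : ℝ) : SeqTest S :=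
  fun n s => if divK (empTrans n s) θ₀ < (η : EReal) then false else true

/-- The alternative `π₁` (with stationary transition distribution `θ₁`) is nondegenerate with
respect to the null hypothesis `π₀` (with `θ₀`) and the threshold `η`: either no shift-invariant
`ν` satisfies both `D_K(ν, θ₀) ≤ η` and `D_K(ν, θ₁) < ∞`, or some `ν` satisfies both
`D_K(ν, θ₀) < η` and `D_K(ν, θ₁) < ∞` and the transitions possible under both hypotheses form an
irreducible (strongly connected) graph. -/
def NondegenerateAlternative {S A : Type*} [Fintype S] [Fintype A] (M : MDP S A)
    (π₀ π₁ : StationaryPolicy S A) (θ₀ θ₁ : S → S → ℝ) (η : ℝ) : Prop :=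
  (∀ ν ∈ ShiftInvariant S, divK ν θ₁ < ⊤ → (η : EReal) < divK ν θ₀) ∨
  ((∃ ν ∈ ShiftInvariant S, divK ν θ₀ < (η : EReal) ∧ divK ν θ₁ < ⊤) ∧
    (Matrix.hadamard (M.induced π₀) (M.induced π₁)).IsIrreducible)

end

/-!
The proof is the method of types for Markov chains. The likelihood ratio of a state sequence between
two transition matrices depends only on its empirical transition distribution
(`prod_transition_eq`). Two consequences carry the theorem.

*Upper bounds.* Comparing `T` with the transition matrix of the sequence itself costs a factor
`2 ^ (-n * divRate T ν)`, where `ν` is the empirical distribution, and there are only polynomially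
many empirical distributions. Hence an event whose empirical distributions all have divergence at
least `a` from `T` has probability at most about `2 ^ (-n * a)` (`sum_seqProb_le_of_le_divRate`).
For the type I error of the divergence test this is the required bound. For the type II error the
empirical distributions are only approximately shift-invariant, so that a compactness argument
(`exists_mem_shiftInvariant_of_frequently`) gives the infimum over the closed set where the
divergence from the null hypothesis is at most `η`. Under nondegeneracy it agrees with the infimum
over the strict inequality, by convexity of the divergence (`exists_divRate_lt_of_le`),
or both are infinite.

*Lower bounds.* Let `ν` be shift-invariant and irreducible. The upper bound and compactness also
give the law of large numbers for the chain with transition distribution `ν`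
(`eventually_sum_seqProb_compl_le`), since `ν` is the only zero of the divergence from this chain.
So an event that is likely for this chain has probability at least about `2 ^ (-n * divRate T ν)`
under `T` (`eventually_le_sum_seqProb`). Applied to the null hypothesis, this shows that a test with
type I exponent `η` must accept the chain of `ν` with probability at least one half whenever
`divRate T₀ ν < η`; applied to the alternative, it then bounds the type II error of any such test
from below, which is the optimality of the divergence test. General `ν` are reduced to irreducible
ones by mixing in a stationary distribution supported on the transitions common to both hypotheses
(`exists_isIrreducible_divRate_lt`). For the type I error, the stationary transition distribution of
the null hypothesis is mixed with a `ν` of divergence above `η`, until the divergence is slightly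
above `η`.

Throughout, `divRate` replaces the extended-real `divK` by its finite part, a continuous function on
all of `S → S → ℝ`, together with the closed condition `SupportedOn`.
-/

noncomputable section

/-! ### Irreducible matrices and stationary vectors -/

/-- Irreducibility of a nonnegative matrix as reachability of every index from every index
along positive entries. -/
theorem Matrix.isIrreducible_iff_transGen {S : Type*} {B : Matrix S S ℝ} :
    B.IsIrreducible ↔
      (∀ i j, 0 ≤ B i j) ∧ ∀ i j, Relation.TransGen (fun a b => 0 < B a b) i j := by
  let : Quiver S := B.toQuiver
  constructor
  · refine fun h => ⟨h.nonneg, fun i j => ?_⟩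
    obtain ⟨p, hp⟩ := h.connected i j
    induction p with
    | nil => simp at hp
    | @cons b c q e ih =>
      rcases Nat.eq_zero_or_pos q.length with h0 | h0
      · obtain rfl := Quiver.Path.eq_of_length_zero q h0
        exact .single e.down
      · exact (ih h0).tail e.down
  · rintro ⟨h0, h⟩
    refine ⟨h0, fun i j => ?_⟩
    induction h i j with
    | single e => exact ⟨Quiver.Hom.toPath (PLift.up e), by simp⟩
    | tail _ e ih =>
      obtain ⟨p, -⟩ := ih
      exact ⟨p.cons (PLift.up e), by simp⟩

namespace Matrix.IsIrreducible

variable {S : Type*} {B C : Matrix S S ℝ}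

theorem of_pos_imp_pos (hB : B.IsIrreducible) (hC : ∀ i j, 0 ≤ C i j)
    (h : ∀ i j, 0 < B i j → 0 < C i j) : C.IsIrreducible := by
  rw [Matrix.isIrreducible_iff_transGen] at hB ⊢
  exact ⟨hC, fun i j => Relation.TransGen.mono h i j (hB.2 i j)⟩

theorem forall_of_closed (hB : B.IsIrreducible) {P : S → Prop}
    (hP : ∀ i j, 0 < B i j → P i → P j) {i : S} (hi : P i) (j : S) : P j := by
  induction (Matrix.isIrreducible_iff_transGen.1 hB).2 i j with
  | single e => exact hP _ _ e hi
  | tail _ e ih => exact hP _ _ e ih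

theorem sum_row_pos [Fintype S] (hB : B.IsIrreducible) (i : S) : 0 < ∑ j, B i j := by
  obtain ⟨j, hj, -⟩ :=
    Relation.TransGen.head'_iff.1 ((Matrix.isIrreducible_iff_transGen.1 hB).2 i i)
  exact Finset.sum_pos' (fun j _ => hB.nonneg i j) ⟨j, Finset.mem_univ j, hj⟩

theorem pos_of_stationary [Fintype S] (hB : B.IsIrreducible) {τ : S → ℝ} (h0 : ∀ i, 0 ≤ τ i)
    (hτ : Matrix.vecMul τ B = τ) {i : S} (hi : 0 < τ i) (j : S) : 0 < τ j := by
  refine hB.forall_of_closed (P := fun i => 0 < τ i) (fun a b hab ha => ?_) hi j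
  rw [← hτ]
  exact Finset.sum_pos' (fun k _ => mul_nonneg (h0 k) (hB.nonneg k b))
    ⟨a, Finset.mem_univ a, mul_pos ha hab⟩

theorem pos_of_mem_stdSimplex [Fintype S] (hB : B.IsIrreducible) {τ : S → ℝ}
    (h : τ ∈ stdSimplex ℝ S) (hτ : Matrix.vecMul τ B = τ) (j : S) : 0 < τ j := by
  have : ∃ i ∈ Finset.univ, 0 < τ i := by
    apply Finset.exists_lt_of_sum_lt
    simp [h.2]
  obtain ⟨i, -, hi⟩ := this
  exact hB.pos_of_stationary h.1 hτ hi j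

/-- Uniqueness of the stationary distribution: subtracting the largest multiple of one stationary
vector that leaves the other one nonnegative produces a stationary vector with a zero entry. -/
theorem eq_of_stationary [Fintype S] (hB : B.IsIrreducible) {τ σ : S → ℝ}
    (hτs : τ ∈ stdSimplex ℝ S) (hσs : σ ∈ stdSimplex ℝ S)
    (hτ : Matrix.vecMul τ B = τ) (hσ : Matrix.vecMul σ B = σ) : σ = τ := by
  have hpos := hB.pos_of_mem_stdSimplex hτs hτ
  have : Nonempty S := by
    by_contra h
    rw [not_nonempty_iff] at h
    simpa using hτs.2
  obtain ⟨k, hk⟩ := Finite.exists_min (fun i => σ i / τ i)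
  set c := σ k / τ k with hc
  have hx0 : ∀ i, 0 ≤ (σ - c • τ) i := fun i => by
    have := (le_div_iff₀ (hpos i)).1 (hk i)
    simpa using this
  have hxs : Matrix.vecMul (σ - c • τ) B = σ - c • τ := by
    rw [Matrix.sub_vecMul, Matrix.smul_vecMul, hτ, hσ]
  have hxk : (σ - c • τ) k = 0 := by
    simp [hc, div_mul_cancel₀ _ (hpos k).ne']
  have hx : ∀ i, σ i = c * τ i := fun i => by
    by_contra h
    have : 0 < (σ - c • τ) i := lt_of_le_of_ne (hx0 i) (by
      simp only [Pi.sub_apply, Pi.smul_apply, smul_eq_mul, ne_eq]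
      intro h'; apply h; linarith)
    exact (hB.pos_of_stationary hx0 hxs this k).ne' hxk
  have hc1 : c = 1 := by
    have := hσs.2
    simp_rw [hx, ← Finset.mul_sum, hτs.2] at this
    linarith
  ext i
  simp [hx, hc1]

end Matrix.IsIrreducible

/-- A stochastic matrix has a stationary distribution: take the absolute values of a left
eigenvector of eigenvalue `1`. -/
theorem exists_stationary {S : Type*} [Fintype S] [DecidableEq S] [Nonempty S]
    {Q : Matrix S S ℝ} (h0 : ∀ i j, 0 ≤ Q i j) (h1 : ∀ i, ∑ j, Q i j = 1) :
    ∃ τ ∈ stdSimplex ℝ S, Matrix.vecMul τ Q = τ := by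
  have hdet : (1 - Q).det = 0 := by
    apply Matrix.exists_mulVec_eq_zero_iff.1
    refine ⟨fun _ => 1, fun h => ?_, ?_⟩
    · simpa using congrFun h (Classical.arbitrary S)
    · ext i
      simp [Matrix.mulVec, dotProduct, h1, Matrix.one_apply, Finset.sum_sub_distrib]
  obtain ⟨v, hv0, hv⟩ := Matrix.exists_vecMul_eq_zero_iff.2 hdet
  have hv : Matrix.vecMul v Q = v := by
    rw [Matrix.vecMul_sub, Matrix.vecMul_one, sub_eq_zero] at hv
    exact hv.symm
  have hle : ∀ j, |v j| ≤ ∑ i, |v i| * Q i j := fun j => by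
    calc |v j| = |∑ i, v i * Q i j| := by
          conv_lhs => rw [← hv]
          rfl
      _ ≤ ∑ i, |v i * Q i j| := Finset.abs_sum_le_sum_abs _ _
      _ = _ := by simp_rw [abs_mul, abs_of_nonneg (h0 _ j)]
  have hsum : ∑ j, |v j| = ∑ j, ∑ i, |v i| * Q i j := by
    rw [Finset.sum_comm]
    simp_rw [← Finset.mul_sum, h1, mul_one]
  have heq := (Finset.sum_eq_sum_iff_of_le (fun j _ => hle j)).1 hsum
  have hpos : 0 < ∑ j, |v j| := by
    obtain ⟨k, hk⟩ := Function.ne_iff.1 hv0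
    exact Finset.sum_pos' (fun _ _ => abs_nonneg _) ⟨k, Finset.mem_univ k, abs_pos.2 hk⟩
  refine ⟨fun i => |v i| / ∑ j, |v j|, ⟨fun i => by positivity, ?_⟩, ?_⟩
  · rw [← Finset.sum_div, div_self hpos.ne']
  · ext j
    simp only [Matrix.vecMul, dotProduct, div_mul_eq_mul_div, ← Finset.sum_div]
    rw [← heq j (Finset.mem_univ j)]

/-! ### Shift-invariant transition distributions -/

section Marginal

variable {S : Type*} [Fintype S] {ν : S → S → ℝ}

theorem stateMarginal_nonneg (h0 : ∀ s s', 0 ≤ ν s s') (s : S) : 0 ≤ stateMarginal ν s :=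
  Finset.sum_nonneg fun _ _ => h0 _ _

theorem eq_zero_of_stateMarginal_eq_zero (h0 : ∀ s s', 0 ≤ ν s s') {s : S}
    (h : stateMarginal ν s = 0) (s' : S) : ν s s' = 0 :=
  (Finset.sum_eq_zero_iff_of_nonneg fun _ _ => h0 _ _).1 h s' (Finset.mem_univ _)

theorem stateMarginal_mul_condTrans (h0 : ∀ s s', 0 ≤ ν s s') (s s' : S) :
    stateMarginal ν s * condTrans ν s s' = ν s s' := by
  by_cases h : stateMarginal ν s = 0
  · rw [h, zero_mul, eq_zero_of_stateMarginal_eq_zero h0 h]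
  · rw [condTrans, mul_div_cancel₀ _ h]

theorem condTrans_nonneg (h0 : ∀ s s', 0 ≤ ν s s') (s s' : S) : 0 ≤ condTrans ν s s' :=
  div_nonneg (h0 _ _) (stateMarginal_nonneg h0 _)

theorem sum_condTrans_le_one (s : S) : ∑ s', condTrans ν s s' ≤ 1 := by
  simp only [condTrans, ← Finset.sum_div]
  exact div_self_le_one _

theorem sum_condTrans {s : S} (h : stateMarginal ν s ≠ 0) : ∑ s', condTrans ν s s' = 1 := by
  simp only [condTrans, ← Finset.sum_div]
  exact div_self h

theorem condTrans_eq_zero_iff (h0 : ∀ s s', 0 ≤ ν s s') {s s' : S} :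
    condTrans ν s s' = 0 ↔ ν s s' = 0 := by
  rw [condTrans, div_eq_zero_iff, or_iff_left_iff_imp]
  exact fun h => eq_zero_of_stateMarginal_eq_zero h0 h s'

theorem condTrans_pos (h0 : ∀ s s', 0 ≤ ν s s') {s s' : S} (h : 0 < ν s s') :
    0 < condTrans ν s s' :=
  lt_of_le_of_ne (condTrans_nonneg h0 _ _) fun h' =>
    h.ne' ((condTrans_eq_zero_iff h0).1 h'.symm)

theorem stateMarginal_mem_stdSimplex (h : ν ∈ ShiftInvariant S) :
    stateMarginal ν ∈ stdSimplex ℝ S :=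
  ⟨stateMarginal_nonneg h.1, h.2.1⟩

theorem vecMul_stateMarginal_condTrans (h : ν ∈ ShiftInvariant S) :
    Matrix.vecMul (stateMarginal ν) (Matrix.of (condTrans ν)) = stateMarginal ν := by
  ext j
  simp only [Matrix.vecMul, dotProduct, Matrix.of_apply, stateMarginal_mul_condTrans h.1]
  exact (h.2.2 j).symm

theorem mem_shiftInvariant_of_stationary {Q : Matrix S S ℝ} (h0 : ∀ i j, 0 ≤ Q i j)
    (h1 : ∀ i, ∑ j, Q i j = 1) {τ : S → ℝ} (hτ : τ ∈ stdSimplex ℝ S)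
    (hs : Matrix.vecMul τ Q = τ) : (fun s s' => τ s * Q s s') ∈ ShiftInvariant S := by
  refine ⟨fun s s' => mul_nonneg (hτ.1 s) (h0 s s'), ?_, fun i => ?_⟩
  · simp_rw [← Finset.mul_sum, h1, mul_one, hτ.2]
  · simp_rw [← Finset.mul_sum, h1, mul_one]
    exact (congrFun hs i).symm

theorem ShiftInvariant.convex : Convex ℝ (ShiftInvariant S) := by
  rintro ν ⟨h0, h1, h2⟩ ξ ⟨h0', h1', h2'⟩ a b ha hb hab
  refine ⟨fun s s' => ?_, ?_, fun i => ?_⟩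
  · exact add_nonneg (mul_nonneg ha (h0 s s')) (mul_nonneg hb (h0' s s'))
  · simp [Finset.sum_add_distrib, ← Finset.mul_sum, h1, h1', hab]
  · simp [Finset.sum_add_distrib, ← Finset.mul_sum, h2, h2']

theorem ShiftInvariant.isCompact : IsCompact (ShiftInvariant S) := by
  have hc : IsClosed (ShiftInvariant S) := by
    have : ShiftInvariant S = (⋂ s, ⋂ s', {ν | 0 ≤ ν s s'}) ∩ ({ν | ∑ s, ∑ s', ν s s' = 1} ∩
        ⋂ i, {ν | ∑ j, ν i j = ∑ j, ν j i}) := by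
      ext ν; simp [ShiftInvariant]
    rw [this]
    refine IsClosed.inter (isClosed_iInter fun s => isClosed_iInter fun s' => ?_)
      (IsClosed.inter ?_ (isClosed_iInter fun i => ?_))
    · exact isClosed_le (by fun_prop) (by fun_prop)
    · exact isClosed_eq (by fun_prop) (by fun_prop)
    · exact isClosed_eq (by fun_prop) (by fun_prop)
  refine IsCompact.of_isClosed_subset
    (isCompact_univ_pi fun _ : S => isCompact_univ_pi fun _ : S => isCompact_Icc (a := (0 : ℝ))
      (b := 1)) hc ?_
  rintro ν ⟨h0, h1, -⟩ s - s' -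
  refine ⟨h0 s s', ?_⟩
  calc ν s s' ≤ ∑ s', ν s s' :=
        Finset.single_le_sum (fun b _ => h0 s b) (Finset.mem_univ s')
    _ ≤ ∑ s, ∑ s', ν s s' := Finset.single_le_sum (f := fun a => ∑ s', ν a s')
        (fun a _ => Finset.sum_nonneg fun b _ => h0 a b) (Finset.mem_univ s)
    _ = 1 := h1

end Marginal

/-! ### The differential divergence as a continuous real function -/

section SupportedOn

variable {S : Type*} {ν : S → S → ℝ} {T : Matrix S S ℝ}

/-- `ν` charges only transitions that are possible under `T`. -/
def SupportedOn (ν : S → S → ℝ) (T : Matrix S S ℝ) : Prop :=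
  ∀ s s', T s s' = 0 → ν s s' = 0

theorem isClosed_supportedOn : IsClosed {ν | SupportedOn ν T} := by
  simp only [SupportedOn, Set.ofPred_forall]
  exact isClosed_iInter fun s => isClosed_iInter fun s' => isClosed_iInter fun _ =>
    isClosed_eq (by fun_prop) (by fun_prop)

theorem SupportedOn.pos (hT : ∀ s s', 0 ≤ T s s') (h : SupportedOn ν T) {s s' : S}
    (hν : ν s s' ≠ 0) : 0 < T s s' :=
  lt_of_le_of_ne (hT s s') fun h' => hν (h s s' h'.symm)

theorem SupportedOn.mix {ξ : S → S → ℝ} (h : SupportedOn ν T) (h' : SupportedOn ξ T) (a b : ℝ) :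
    SupportedOn (a • ν + b • ξ) T := fun s s' hz => by simp [h s s' hz, h' s s' hz]

end SupportedOn

section Divergence

variable {S : Type*} [Fintype S] {ν : S → S → ℝ} {T : Matrix S S ℝ}

/-- The negative of the conditional entropy (in bits) of the second state given the first one under
`ν`, written so that it is visibly continuous in `ν`: `x ↦ x * log x` is continuous at `0`, where
Lean's `log 0 = 0` is harmless. -/
def negCondEntropy (ν : S → S → ℝ) : ℝ :=
  (∑ s, ∑ s', ν s s' * Real.logb 2 (ν s s')) -
    ∑ s, stateMarginal ν s * Real.logb 2 (stateMarginal ν s)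

/-- The finite part of the differential divergence of `ν` from the transition matrix `T`. It agrees
with `divK` when `ν` is supported on `T`, and is a continuous function of `ν`. -/
def divRate (T : Matrix S S ℝ) (ν : S → S → ℝ) : ℝ :=
  negCondEntropy ν - ∑ s, ∑ s', ν s s' * Real.logb 2 (T s s')

theorem continuous_mul_logb : Continuous fun x : ℝ => x * Real.logb 2 x := by
  have : (fun x : ℝ => x * Real.logb 2 x) = fun x => x * Real.log x / Real.log 2 := by
    ext x; rw [Real.logb, mul_div_assoc]
  rw [this]
  exact Real.continuous_mul_log.div_const _

theorem continuous_stateMarginal (s : S) : Continuous fun ν : S → S → ℝ => stateMarginal ν s := by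
  unfold stateMarginal; fun_prop

theorem continuous_divRate : Continuous (divRate T) := by
  unfold divRate negCondEntropy
  refine ((continuous_finsetSum _ fun s _ => continuous_finsetSum _ fun s' _ => ?_).sub
    (continuous_finsetSum _ fun s _ => ?_)).sub (by fun_prop)
  · exact continuous_mul_logb.comp (by fun_prop : Continuous fun ν : S → S → ℝ => ν s s')
  · exact continuous_mul_logb.comp (continuous_stateMarginal s)

theorem supportedOn_condTrans (h0 : ∀ s s', 0 ≤ ν s s') :
    SupportedOn ν (Matrix.of (condTrans ν)) :=
  fun _ _ h => (condTrans_eq_zero_iff h0).1 h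

theorem divRate_eq_sum (h0 : ∀ s s', 0 ≤ ν s s') (h : SupportedOn ν T) :
    divRate T ν = ∑ s, ∑ s', ν s s' * Real.logb 2 (condTrans ν s s' / T s s') := by
  have hτ : ∑ s, stateMarginal ν s * Real.logb 2 (stateMarginal ν s) =
      ∑ s, ∑ s', ν s s' * Real.logb 2 (stateMarginal ν s) := by
    simp_rw [← Finset.sum_mul]; rfl
  rw [divRate, negCondEntropy, hτ]
  simp_rw [← Finset.sum_sub_distrib]
  refine Finset.sum_congr rfl fun s _ => Finset.sum_congr rfl fun s' _ => ?_
  by_cases hz : ν s s' = 0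
  · simp [hz]
  · have h1 : stateMarginal ν s ≠ 0 := fun h' => hz (eq_zero_of_stateMarginal_eq_zero h0 h' s')
    have h2 : T s s' ≠ 0 := fun h' => hz (h s s' h')
    rw [condTrans, Real.logb_div (div_ne_zero hz h1) h2, Real.logb_div hz h1]
    ring

/-- The change of the divergence with the reference matrix. -/
theorem divRate_eq_add (T Q : Matrix S S ℝ) (ν : S → S → ℝ) :
    divRate T ν = divRate Q ν + (∑ s, ∑ s', ν s s' * Real.logb 2 (Q s s') -
      ∑ s, ∑ s', ν s s' * Real.logb 2 (T s s')) := by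
  unfold divRate; ring

theorem divRate_condTrans (h0 : ∀ s s', 0 ≤ ν s s') : divRate (Matrix.of (condTrans ν)) ν = 0 := by
  rw [divRate_eq_sum h0 (supportedOn_condTrans h0)]
  refine Finset.sum_eq_zero fun s _ => Finset.sum_eq_zero fun s' _ => ?_
  by_cases hz : ν s s' = 0
  · simp [hz]
  · simp [(condTrans_eq_zero_iff h0).not.2 hz]

/-- The pointwise inequality `log x ≤ x - 1` behind Gibbs' inequality. -/
theorem gibbs_term (h0 : ∀ s s', 0 ≤ ν s s') (hT : ∀ s s', 0 ≤ T s s')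
    (h : SupportedOn ν T) (s s' : S) :
    ν s s' - stateMarginal ν s * T s s' ≤
      Real.log 2 * (ν s s' * Real.logb 2 (condTrans ν s s' / T s s')) ∧
    (ν s s' ≠ stateMarginal ν s * T s s' → ν s s' - stateMarginal ν s * T s s' <
      Real.log 2 * (ν s s' * Real.logb 2 (condTrans ν s s' / T s s'))) := by
  have hm := stateMarginal_nonneg h0 s
  by_cases hz : ν s s' = 0
  · simp only [hz, zero_mul, mul_zero, zero_sub, Left.neg_nonpos_iff, Left.neg_neg_iff]
    exact ⟨mul_nonneg hm (hT _ _),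
      fun hne => lt_of_le_of_ne (mul_nonneg hm (hT _ _)) hne⟩
  · have hν : 0 < ν s s' := lt_of_le_of_ne (h0 s s') (Ne.symm hz)
    have hTp := h.pos hT hz
    have hmp : 0 < stateMarginal ν s := lt_of_le_of_ne hm fun h' =>
      hz (eq_zero_of_stateMarginal_eq_zero h0 h'.symm s')
    have hl : Real.log 2 * (ν s s' * Real.logb 2 (condTrans ν s s' / T s s')) =
        -(ν s s' * Real.log (stateMarginal ν s * T s s' / ν s s')) := by
      have h2 : Real.log 2 ≠ 0 := by positivity
      rw [← mul_neg, ← Real.log_inv, inv_div, condTrans, div_div, Real.logb]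
      field_simp
    have hx : 0 < stateMarginal ν s * T s s' / ν s s' := by positivity
    have e : ν s s' * (stateMarginal ν s * T s s' / ν s s' - 1) =
        stateMarginal ν s * T s s' - ν s s' := by field_simp
    rw [hl]
    constructor
    · have := mul_le_mul_of_nonneg_left (Real.log_le_sub_one_of_pos hx) hν.le
      linarith
    · intro hne
      have := mul_lt_mul_of_pos_left (Real.log_lt_sub_one_of_pos hx (by
        rw [ne_eq, div_eq_one_iff_eq hz]; exact hne.symm)) hν
      linarith

theorem sum_gibbs_nonneg (h0 : ∀ s s', 0 ≤ ν s s') (hT1 : ∀ s, ∑ s', T s s' ≤ 1) :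
    0 ≤ ∑ s, ∑ s', (ν s s' - stateMarginal ν s * T s s') := by
  refine Finset.sum_nonneg fun s _ => ?_
  rw [Finset.sum_sub_distrib, ← Finset.mul_sum, sub_nonneg]
  exact mul_le_of_le_one_right (stateMarginal_nonneg h0 s) (hT1 s)

/-- Gibbs' inequality. -/
theorem divRate_nonneg (h0 : ∀ s s', 0 ≤ ν s s') (hT : ∀ s s', 0 ≤ T s s')
    (hT1 : ∀ s, ∑ s', T s s' ≤ 1) (h : SupportedOn ν T) : 0 ≤ divRate T ν := by
  have h2 : 0 < Real.log 2 := Real.log_pos one_lt_two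
  rw [← mul_nonneg_iff_of_pos_left h2, divRate_eq_sum h0 h]
  simp_rw [Finset.mul_sum]
  exact (sum_gibbs_nonneg h0 hT1).trans <| Finset.sum_le_sum fun s _ => Finset.sum_le_sum
    fun s' _ => (gibbs_term h0 hT h s s').1

theorem eq_mul_of_divRate_nonpos (h0 : ∀ s s', 0 ≤ ν s s') (hT : ∀ s s', 0 ≤ T s s')
    (hT1 : ∀ s, ∑ s', T s s' ≤ 1) (h : SupportedOn ν T) (hd : divRate T ν ≤ 0) (s s' : S) :
    ν s s' = stateMarginal ν s * T s s' := by
  by_contra hne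
  have h2 : 0 < Real.log 2 := Real.log_pos one_lt_two
  refine absurd (mul_nonpos_of_nonneg_of_nonpos h2.le hd) (not_le.2 ?_)
  rw [divRate_eq_sum h0 h]
  simp_rw [Finset.mul_sum]
  refine (sum_gibbs_nonneg h0 hT1).trans_lt <| Finset.sum_lt_sum (fun s _ => Finset.sum_le_sum
    fun s' _ => (gibbs_term h0 hT h s s').1) ⟨s, Finset.mem_univ s, ?_⟩
  exact Finset.sum_lt_sum (fun s' _ => (gibbs_term h0 hT h s s').1)
    ⟨s', Finset.mem_univ s', (gibbs_term h0 hT h s s').2 hne⟩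

/-- Convexity of the divergence. With `Q` the transition matrix of the mixture, both divergences are
bounded below by the functional `ξ ↦ ∑ ξ * log (Q / T)`, which is linear and equals the divergence
at the mixture. -/
theorem divRate_mix_le {ξ : S → S → ℝ} (h0 : ∀ s s', 0 ≤ ν s s') (h0' : ∀ s s', 0 ≤ ξ s s')
    {a b : ℝ} (ha : 0 < a) (hb : 0 < b) :
    divRate T (a • ν + b • ξ) ≤ a * divRate T ν + b * divRate T ξ := by
  set ω := a • ν + b • ξ with hω
  have hω' : ∀ s s', ω s s' = a * ν s s' + b * ξ s s' := fun s s' => by simp [hω]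
  have hω0 : ∀ s s', 0 ≤ ω s s' := fun s s' => by
    rw [hω']; have := h0 s s'; have := h0' s s'; positivity
  set Q := Matrix.of (condTrans ω)
  have hQ0 : ∀ s s', 0 ≤ Q s s' := condTrans_nonneg hω0
  have hQ1 : ∀ s, ∑ s', Q s s' ≤ 1 := sum_condTrans_le_one
  have hωz : ∀ s s', Q s s' = 0 → ν s s' = 0 ∧ ξ s s' = 0 := fun s s' h => by
    have e := supportedOn_condTrans hω0 s s' h
    rw [hω'] at e
    have h1 := mul_nonneg ha.le (h0 s s')
    have h2 := mul_nonneg hb.le (h0' s s')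
    exact ⟨(mul_eq_zero.1 (by linarith : a * ν s s' = 0)).resolve_left ha.ne',
      (mul_eq_zero.1 (by linarith : b * ξ s s' = 0)).resolve_left hb.ne'⟩
  have h1 := divRate_nonneg h0 hQ0 hQ1 fun s s' h => (hωz s s' h).1
  have h2 := divRate_nonneg h0' hQ0 hQ1 fun s s' h => (hωz s s' h).2
  have lin : ∀ B : Matrix S S ℝ, ∑ s, ∑ s', ω s s' * Real.logb 2 (B s s') =
      a * ∑ s, ∑ s', ν s s' * Real.logb 2 (B s s') +
      b * ∑ s, ∑ s', ξ s s' * Real.logb 2 (B s s') := fun B => by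
    simp only [Finset.mul_sum, ← Finset.sum_add_distrib, hω']
    exact Finset.sum_congr rfl fun s _ => Finset.sum_congr rfl fun s' _ => by ring
  rw [divRate_eq_add T Q ω, divRate_eq_add T Q ν, divRate_eq_add T Q ξ, divRate_condTrans hω0,
    lin, lin]
  nlinarith [mul_nonneg ha.le h1, mul_nonneg hb.le h2]

theorem divK_eq {θ : S → S → ℝ} (h0 : ∀ s s', 0 ≤ ν s s')
    (hθ : ∀ s s', condTrans θ s s' = T s s') :
    (SupportedOn ν T → divK ν θ = (divRate T ν : ℝ)) ∧ (¬ SupportedOn ν T → divK ν θ = ⊤) := by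
  have hiff : (∃ s s', 0 < ν s s' ∧ condTrans θ s s' = 0) ↔ ¬ SupportedOn ν T := by
    simp only [SupportedOn, not_forall, hθ]
    exact ⟨fun ⟨s, s', h1, h2⟩ => ⟨s, s', h2, h1.ne'⟩,
      fun ⟨s, s', h2, h1⟩ => ⟨s, s', lt_of_le_of_ne (h0 s s') (Ne.symm h1), h2⟩⟩
  constructor
  · intro h
    rw [divK, if_neg (by rw [hiff]; exact not_not.2 h), divRate_eq_sum h0 h]
    simp_rw [Finset.mul_sum, ← mul_assoc, stateMarginal_mul_condTrans h0, hθ]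
  · intro h
    rw [divK, if_pos (hiff.2 h)]

theorem divK_lt_coe_iff {θ : S → S → ℝ} (h0 : ∀ s s', 0 ≤ ν s s')
    (hθ : ∀ s s', condTrans θ s s' = T s s') {a : ℝ} :
    divK ν θ < (a : EReal) ↔ SupportedOn ν T ∧ divRate T ν < a := by
  by_cases h : SupportedOn ν T
  · simp [(divK_eq h0 hθ).1 h, h]
  · simp [(divK_eq h0 hθ).2 h, h]

theorem divK_lt_top_iff {θ : S → S → ℝ} (h0 : ∀ s s', 0 ≤ ν s s')
    (hθ : ∀ s s', condTrans θ s s' = T s s') : divK ν θ < ⊤ ↔ SupportedOn ν T := by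
  by_cases h : SupportedOn ν T
  · simp [(divK_eq h0 hθ).1 h, h]
  · simp [(divK_eq h0 hθ).2 h, h]

theorem condTrans_of_isTransitionFreq {θ : S → S → ℝ} (hT : T.IsIrreducible)
    (hT1 : ∀ s, ∑ s', T s s' = 1) (h : IsTransitionFreq T θ) (s s' : S) :
    condTrans θ s s' = T s s' := by
  obtain ⟨τ, hτ, hs, hθ⟩ := h
  have hp := hT.pos_of_mem_stdSimplex hτ hs s
  have : stateMarginal θ s = τ s := by
    simp_rw [stateMarginal, hθ, ← Finset.mul_sum, hT1, mul_one]
  rw [condTrans, this, hθ, mul_div_cancel_left₀ _ hp.ne']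

theorem stateMarginal_pos (hirr : (Matrix.of ν).IsIrreducible) (s : S) : 0 < stateMarginal ν s :=
  hirr.sum_row_pos s

theorem isIrreducible_condTrans (hirr : (Matrix.of ν).IsIrreducible) :
    (Matrix.of (condTrans ν)).IsIrreducible :=
  hirr.of_pos_imp_pos (condTrans_nonneg hirr.nonneg) fun _ _ => condTrans_pos hirr.nonneg

/-- The only shift-invariant distribution of divergence zero from an irreducible chain is its own
stationary transition distribution. -/
theorem eq_of_divRate_condTrans_nonpos (hν : ν ∈ ShiftInvariant S)
    (hirr : (Matrix.of ν).IsIrreducible) {ξ : S → S → ℝ} (hξ : ξ ∈ ShiftInvariant S)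
    (hsupp : SupportedOn ξ (Matrix.of (condTrans ν)))
    (h : divRate (Matrix.of (condTrans ν)) ξ ≤ 0) : ξ = ν := by
  have hQ := isIrreducible_condTrans hirr
  have he := eq_mul_of_divRate_nonpos hξ.1 hQ.nonneg sum_condTrans_le_one hsupp h
  have hst : Matrix.vecMul (stateMarginal ξ) (Matrix.of (condTrans ν)) = stateMarginal ξ := by
    ext j
    simp only [Matrix.vecMul, dotProduct, ← he]
    exact (hξ.2.2 j).symm
  have hm := hQ.eq_of_stationary (stateMarginal_mem_stdSimplex hν)
    (stateMarginal_mem_stdSimplex hξ) (vecMul_stateMarginal_condTrans hν) hst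
  ext s s'
  rw [he, hm]
  exact stateMarginal_mul_condTrans hν.1 s s'

end Divergence

/-! ### State sequences and their empirical transition distributions -/

section Sequences

variable {S : Type*}

theorem seqProb_nonneg {p : S → ℝ} {T : Matrix S S ℝ} (hp : ∀ s, 0 ≤ p s)
    (hT : ∀ s s', 0 ≤ T s s') : ∀ (n : ℕ) (s : Fin n → S), 0 ≤ seqProb p T n s
  | 0, _ => zero_le_one
  | _ + 1, _ => mul_nonneg (hp _) (Finset.prod_nonneg fun _ _ => hT _ _)

/-- Summing out the first state moves the initial distribution one step forward. -/
theorem sum_seqProb_add_two [Fintype S] (p : S → ℝ) (T : Matrix S S ℝ) (n : ℕ) :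
    ∑ s, seqProb p T (n + 2) s = ∑ s, seqProb (Matrix.vecMul p T) T (n + 1) s := by
  rw [← (Fin.consEquiv fun _ : Fin (n + 2) => S).sum_comp, Fintype.sum_prod_type,
    Finset.sum_comm]
  refine Finset.sum_congr rfl fun s _ => ?_
  simp only [seqProb, Matrix.vecMul, dotProduct, Finset.sum_mul]
  refine Finset.sum_congr rfl fun x _ => ?_
  rw [Fin.prod_univ_succ]
  simp [Fin.consEquiv, mul_assoc]

theorem sum_seqProb_one [Fintype S] (p : S → ℝ) (T : Matrix S S ℝ) :
    ∑ s, seqProb p T 1 s = ∑ i, p i := by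
  rw [← (Equiv.funUnique (Fin 1) S).symm.sum_comp]
  simp [seqProb]

theorem sum_vecMul [Fintype S] (p : S → ℝ) (T : Matrix S S ℝ) :
    ∑ j, Matrix.vecMul p T j = ∑ i, p i * ∑ j, T i j := by
  simp only [Matrix.vecMul, dotProduct, Finset.mul_sum]
  exact Finset.sum_comm

theorem sum_seqProb_le [Fintype S] {T : Matrix S S ℝ} (hT : ∀ s s', 0 ≤ T s s')
    (hT1 : ∀ s, ∑ s', T s s' ≤ 1) (n : ℕ) {p : S → ℝ} (hp : ∀ s, 0 ≤ p s) :
    ∑ s, seqProb p T (n + 1) s ≤ ∑ i, p i := by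
  induction n generalizing p with
  | zero => rw [sum_seqProb_one]
  | succ n ih =>
    rw [sum_seqProb_add_two]
    have hpT : ∀ s, 0 ≤ Matrix.vecMul p T s := fun s =>
      Finset.sum_nonneg fun i _ => mul_nonneg (hp i) (hT i s)
    refine (ih hpT).trans ?_
    rw [sum_vecMul]
    exact Finset.sum_le_sum fun i _ => mul_le_of_le_one_right (hp i) (hT1 i)

theorem sum_seqProb_eq [Fintype S] {T : Matrix S S ℝ} (hT1 : ∀ s, ∑ s', T s s' = 1) (n : ℕ)
    (p : S → ℝ) : ∑ s, seqProb p T (n + 1) s = ∑ i, p i := by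
  induction n generalizing p with
  | zero => rw [sum_seqProb_one]
  | succ n ih =>
    rw [sum_seqProb_add_two, ih, sum_vecMul]
    simp [hT1]

section Empirical

variable [DecidableEq S]

theorem sum_empTrans_mul [Fintype S] {n : ℕ} (s : Fin (n + 1) → S) (f : S → S → ℝ) :
    ∑ a, ∑ b, empTrans (n + 1) s a b * f a b = (∑ t : Fin n, f (s t.castSucc) (s t.succ)) / n := by
  simp only [empTrans, div_mul_eq_mul_div, ← Finset.sum_div, Finset.sum_mul]
  congr 1
  rw [Finset.sum_congr rfl fun a _ => Finset.sum_comm, Finset.sum_comm]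
  refine Finset.sum_congr rfl fun t _ => ?_
  simp [ite_and]

theorem empTrans_nonneg : ∀ {n : ℕ} (s : Fin n → S) (a b : S), 0 ≤ empTrans n s a b
  | 0, _, _, _ => le_rfl
  | _ + 1, _, _, _ => div_nonneg (Finset.sum_nonneg fun _ _ => by split_ifs <;> norm_num)
      (Nat.cast_nonneg _)

theorem exists_of_empTrans_ne_zero {n : ℕ} {s : Fin (n + 1) → S} {a b : S}
    (h : empTrans (n + 1) s a b ≠ 0) : ∃ t : Fin n, s t.castSucc = a ∧ s t.succ = b := by
  by_contra! h'
  apply h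
  simp only [empTrans]
  rw [Finset.sum_eq_zero fun t _ => if_neg fun e => h' t e.1 e.2, zero_div]

theorem empTrans_pos {n : ℕ} (s : Fin (n + 1) → S) (t : Fin n) :
    0 < empTrans (n + 1) s (s t.castSucc) (s t.succ) := by
  refine div_pos (Finset.sum_pos' (fun _ _ => by split_ifs <;> norm_num)
    ⟨t, Finset.mem_univ t, by simp⟩) (Nat.cast_pos.2 (Fin.pos t))

theorem supportedOn_empTrans {n : ℕ} {s : Fin (n + 1) → S} {T : Matrix S S ℝ}
    (h : ∀ t : Fin n, 0 < T (s t.castSucc) (s t.succ)) : SupportedOn (empTrans (n + 1) s) T := by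
  intro a b hz
  by_contra hne
  obtain ⟨t, rfl, rfl⟩ := exists_of_empTrans_ne_zero hne
  exact (h t).ne' hz

theorem empTrans_le_one {n : ℕ} (s : Fin n → S) (a b : S) : empTrans n s a b ≤ 1 := by
  cases n with
  | zero => exact zero_le_one
  | succ n =>
    refine div_le_one_of_le₀ ?_ (Nat.cast_nonneg _)
    calc _ ≤ ∑ t : Fin n, (1 : ℝ) := Finset.sum_le_sum fun _ _ => by split_ifs <;> norm_num
      _ = n := by simp

theorem sum_empTrans_eq_one [Fintype S] {n : ℕ} (hn : n ≠ 0) (s : Fin (n + 1) → S) :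
    ∑ a, ∑ b, empTrans (n + 1) s a b = 1 := by
  have := sum_empTrans_mul s fun _ _ => 1
  simp only [mul_one] at this
  rw [this]
  simp [hn]

/-- The two marginals of an empirical transition distribution differ only through the first and the
last state of the sequence. -/
theorem abs_marginal_empTrans_sub_le [Fintype S] {n : ℕ} (s : Fin (n + 1) → S) (i : S) :
    |∑ j, empTrans (n + 1) s i j - ∑ j, empTrans (n + 1) s j i| ≤ 1 / n := by
  have h1 := sum_empTrans_mul s fun a _ => if a = i then 1 else 0
  have h2 := sum_empTrans_mul s fun _ b => if b = i then 1 else 0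
  simp only [mul_ite, mul_one, mul_zero, Finset.sum_ite_irrel, Finset.sum_const_zero,
    Finset.sum_ite_eq', Finset.mem_univ, if_true] at h1 h2
  have h3 := (Fin.sum_univ_castSucc fun t => if s t = i then (1 : ℝ) else 0).symm.trans
    (Fin.sum_univ_succ fun t => if s t = i then (1 : ℝ) else 0)
  rw [h1, h2, ← sub_div, abs_div, Nat.abs_cast]
  gcongr
  rw [abs_le]
  split_ifs at h3 <;> constructor <;> linarith

/-- Change of measure between two transition matrices: the likelihood ratio of a sequence depends
on the sequence only through its empirical transition distribution. -/
theorem prod_transition_eq [Fintype S] {n : ℕ} {s : Fin (n + 1) → S} {T Q : Matrix S S ℝ}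
    (hT : ∀ t : Fin n, 0 < T (s t.castSucc) (s t.succ))
    (hQ : ∀ t : Fin n, 0 < Q (s t.castSucc) (s t.succ)) :
    ∏ t : Fin n, T (s t.castSucc) (s t.succ) =
      (2 : ℝ) ^ (-(n * ((∑ a, ∑ b, empTrans (n + 1) s a b * Real.logb 2 (Q a b)) -
        ∑ a, ∑ b, empTrans (n + 1) s a b * Real.logb 2 (T a b)))) *
      ∏ t : Fin n, Q (s t.castSucc) (s t.succ) := by
  have key : ∀ B : Matrix S S ℝ, (∀ t : Fin n, 0 < B (s t.castSucc) (s t.succ)) →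
      ∏ t : Fin n, B (s t.castSucc) (s t.succ) =
        (2 : ℝ) ^ (n * ∑ a, ∑ b, empTrans (n + 1) s a b * Real.logb 2 (B a b)) := fun B hB => by
    have : (n : ℝ) * ∑ a, ∑ b, empTrans (n + 1) s a b * Real.logb 2 (B a b) =
        ∑ t : Fin n, Real.logb 2 (B (s t.castSucc) (s t.succ)) := by
      rw [sum_empTrans_mul s fun a b => Real.logb 2 (B a b)]
      rcases Nat.eq_zero_or_pos n with rfl | hn
      · simp
      · rw [mul_div_cancel₀]; positivity
    rw [this, Real.rpow_sum_of_pos two_pos]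
    exact Finset.prod_congr rfl fun t _ =>
      (Real.rpow_logb two_pos (by norm_num) (hB t)).symm
  rw [key T hT, key Q hQ, ← Real.rpow_add two_pos]
  congr 1
  ring

/-- The number of empirical transition distributions of sequences of a given length is polynomial
in the length. -/
theorem card_image_empTrans_le [Fintype S] (n : ℕ) :
    (Finset.univ.image (empTrans (S := S) (n + 1))).card ≤
      (n + 1) ^ (Fintype.card S * Fintype.card S) := by
  classical
  let F : (S → S → Fin (n + 1)) → S → S → ℝ := fun k a b => ((k a b : ℕ) : ℝ) / n
  have hsub : Finset.univ.image (empTrans (S := S) (n + 1)) ⊆ Finset.univ.image F := by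
    intro c hc
    obtain ⟨s, -, rfl⟩ := Finset.mem_image.1 hc
    refine Finset.mem_image.2 ⟨fun a b =>
      ⟨(Finset.univ.filter fun t : Fin n => s t.castSucc = a ∧ s t.succ = b).card,
        Nat.lt_succ_of_le ((Finset.card_le_univ _).trans (by simp))⟩, Finset.mem_univ _, ?_⟩
    ext a b
    simp [F, empTrans]
  refine (Finset.card_le_card hsub).trans (Finset.card_image_le.trans ?_)
  simp [pow_mul]

/-- A sequence is less likely under `T` than under its own empirical transition matrix by a factor
that decays exponentially at the rate of the divergence. -/
theorem seqProb_le_condTrans [Fintype S] {n : ℕ} {s : Fin (n + 1) → S} {p : S → ℝ}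
    {T : Matrix S S ℝ} (hp : ∀ s, 0 ≤ p s) (hT : ∀ s s', 0 ≤ T s s') {a : ℝ}
    (h : SupportedOn (empTrans (n + 1) s) T → a ≤ divRate T (empTrans (n + 1) s)) :
    seqProb p T (n + 1) s ≤
      (2 : ℝ) ^ (-(n * a)) * seqProb p (Matrix.of (condTrans (empTrans (n + 1) s))) (n + 1) s := by
  have hQ : ∀ t : Fin n,
      0 < Matrix.of (condTrans (empTrans (n + 1) s)) (s t.castSucc) (s t.succ) :=
    fun t => condTrans_pos (empTrans_nonneg s) (empTrans_pos s t)
  by_cases hpos : ∀ t : Fin n, 0 < T (s t.castSucc) (s t.succ)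
  · have e := divRate_eq_add T (Matrix.of (condTrans (empTrans (n + 1) s))) (empTrans (n + 1) s)
    rw [divRate_condTrans (empTrans_nonneg s), zero_add] at e
    simp only [seqProb]
    rw [prod_transition_eq hpos hQ, ← e, mul_left_comm]
    gcongr
    · exact mul_nonneg (hp _) (Finset.prod_nonneg fun t _ => (hQ t).le)
    · norm_num
    · exact h (supportedOn_empTrans hpos)
  · push Not at hpos
    obtain ⟨t, ht⟩ := hpos
    have : seqProb p T (n + 1) s = 0 := by
      simp only [seqProb]
      rw [Finset.prod_eq_zero (Finset.mem_univ t) (le_antisymm ht (hT _ _)), mul_zero]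
    rw [this]
    exact mul_nonneg (by positivity)
      (seqProb_nonneg hp (condTrans_nonneg (empTrans_nonneg s)) _ _)

/-- The method of types: an event whose empirical transition distributions all have divergence at
least `a` from `T` has probability at most a polynomial times `2 ^ (-n * a)`. -/
theorem sum_seqProb_le_of_le_divRate [Fintype S] {p : S → ℝ} {T : Matrix S S ℝ}
    (hp : p ∈ stdSimplex ℝ S) (hT : ∀ s s', 0 ≤ T s s') {n : ℕ} {a : ℝ}
    (B : Finset (Fin (n + 1) → S))
    (hB : ∀ s ∈ B, SupportedOn (empTrans (n + 1) s) T → a ≤ divRate T (empTrans (n + 1) s)) :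
    ∑ s ∈ B, seqProb p T (n + 1) s ≤
      (n + 1 : ℝ) ^ (Fintype.card S * Fintype.card S) * (2 : ℝ) ^ (-(n * a)) := by
  classical
  have hnn : ∀ (c s : Fin (n + 1) → S),
      0 ≤ seqProb p (Matrix.of (condTrans (empTrans (n + 1) c))) (n + 1) s := fun c s =>
    seqProb_nonneg hp.1 (condTrans_nonneg (empTrans_nonneg c)) _ _
  have htypes : ∑ s : Fin (n + 1) → S,
      seqProb p (Matrix.of (condTrans (empTrans (n + 1) s))) (n + 1) s ≤
        (Finset.univ.image (empTrans (S := S) (n + 1))).card := by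
    rw [← Finset.sum_fiberwise_of_maps_to
      (fun s _ => Finset.mem_image_of_mem (empTrans (n + 1)) (Finset.mem_univ s))]
    rw [← nsmul_one, ← Finset.sum_const]
    refine Finset.sum_le_sum fun c hc => ?_
    obtain ⟨s₀, -, rfl⟩ := Finset.mem_image.1 hc
    calc _ = ∑ s with empTrans (n + 1) s = empTrans (n + 1) s₀,
          seqProb p (Matrix.of (condTrans (empTrans (n + 1) s₀))) (n + 1) s :=
          Finset.sum_congr rfl fun s hs => by rw [(Finset.mem_filter.1 hs).2]
      _ ≤ ∑ s, seqProb p (Matrix.of (condTrans (empTrans (n + 1) s₀))) (n + 1) s :=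
          Finset.sum_le_univ_sum_of_nonneg fun s => hnn s₀ s
      _ ≤ ∑ i, p i := sum_seqProb_le (condTrans_nonneg (empTrans_nonneg s₀))
          sum_condTrans_le_one n hp.1
      _ = 1 := hp.2
  calc ∑ s ∈ B, seqProb p T (n + 1) s
      ≤ ∑ s ∈ B, (2 : ℝ) ^ (-(n * a)) *
          seqProb p (Matrix.of (condTrans (empTrans (n + 1) s))) (n + 1) s :=
        Finset.sum_le_sum fun s hs => seqProb_le_condTrans hp.1 hT (hB s hs)
    _ ≤ (2 : ℝ) ^ (-(n * a)) * ∑ s : Fin (n + 1) → S,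
          seqProb p (Matrix.of (condTrans (empTrans (n + 1) s))) (n + 1) s := by
        rw [← Finset.mul_sum]
        gcongr
        exacts [fun s _ _ => hnn s s, Finset.subset_univ B]
    _ ≤ (2 : ℝ) ^ (-(n * a)) * (n + 1 : ℝ) ^ (Fintype.card S * Fintype.card S) := by
        gcongr
        refine htypes.trans ?_
        exact_mod_cast card_image_empTrans_le n
    _ = _ := mul_comm _ _

end Empirical

end Sequences

/-! ### Asymptotic bounds -/

theorem eventually_const_le_rpow (c : ℝ) {d : ℝ} (hd : 0 < d) :
    ∀ᶠ n : ℕ in atTop, c ≤ (2 : ℝ) ^ (n * d) := by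
  have h : Tendsto (fun n : ℕ => ((2 : ℝ) ^ d) ^ n) atTop atTop :=
    tendsto_pow_atTop_atTop_of_one_lt (Real.one_lt_rpow one_lt_two hd)
  filter_upwards [h.eventually_ge_atTop c] with n hn
  rwa [mul_comm, Real.rpow_mul two_pos.le, Real.rpow_natCast]

theorem eventually_pow_mul_rpow_le (k : ℕ) {a b : ℝ} (h : b < a) :
    ∀ᶠ n : ℕ in atTop, ((n : ℝ) + 1) ^ k * (2 : ℝ) ^ (-(n * a)) ≤
      (2 : ℝ) ^ (-((n + 1 : ℕ) * b)) := by
  have hr : 1 < (2 : ℝ) ^ (a - b) := Real.one_lt_rpow one_lt_two (sub_pos.2 h)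
  have h1 := ((isLittleO_pow_const_const_pow_of_one_lt (R := ℝ) k hr).comp_tendsto
    (tendsto_add_atTop_nat 1)).def (show 0 < (2 : ℝ) ^ (-a) by positivity)
  filter_upwards [h1] with n hn
  simp only [Function.comp_apply, norm_pow, Real.norm_natCast] at hn
  rw [Real.norm_of_nonneg (by positivity), ← Real.rpow_natCast (_ ^ (a - b)),
    ← Real.rpow_mul two_pos.le, ← Real.rpow_add two_pos] at hn
  push_cast at hn ⊢
  calc ((n : ℝ) + 1) ^ k * (2 : ℝ) ^ (-(n * a))
      ≤ (2 : ℝ) ^ (-a + (a - b) * (n + 1)) * (2 : ℝ) ^ (-(n * a)) := by gcongr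
    _ = _ := by rw [← Real.rpow_add two_pos]; congr 1; ring

section Asymptotics

variable {S : Type*} [Fintype S] [DecidableEq S]

/-- The method of types in asymptotic form, with the polynomial factor absorbed. -/
theorem eventually_sum_seqProb_le {p : S → ℝ} {T : Matrix S S ℝ}
    (hp : p ∈ stdSimplex ℝ S) (hT : ∀ s s', 0 ≤ T s s') {a b : ℝ} (h : b < a) :
    ∀ᶠ n : ℕ in atTop, ∀ B : Finset (Fin n → S),
      (∀ s ∈ B, SupportedOn (empTrans n s) T → a ≤ divRate T (empTrans n s)) →
      ∑ s ∈ B, seqProb p T n s ≤ (2 : ℝ) ^ (-(n * b)) := by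
  rw [← map_add_atTop_eq_nat 1, eventually_map]
  filter_upwards [eventually_pow_mul_rpow_le (Fintype.card S * Fintype.card S) h] with n hn B hB
  exact (sum_seqProb_le_of_le_divRate hp hT B hB).trans hn

/-- Empirical transition distributions accumulate only at shift-invariant distributions. -/
theorem exists_mem_shiftInvariant_of_frequently {C : Set (S → S → ℝ)} (hC : IsClosed C)
    (h : ∃ᶠ n in atTop, ∃ s : Fin n → S, empTrans n s ∈ C) : ∃ ν ∈ ShiftInvariant S, ν ∈ C := by
  obtain ⟨φ, hφ, hφs⟩ := extraction_of_frequently_atTop (h.and_eventually (eventually_ge_atTop 2))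
  choose s hs using fun k => (hφs k).1
  have hφ2 := fun k => (hφs k).2
  obtain ⟨ν, -, ψ, hψ, hlim⟩ := (isCompact_univ_pi fun _ : S => isCompact_univ_pi fun _ : S =>
    isCompact_Icc (a := (0 : ℝ)) (b := 1)).tendsto_subseq
    (x := fun k => empTrans (φ k) (s k))
    (fun k a _ b _ => ⟨empTrans_nonneg _ a b, empTrans_le_one _ a b⟩)
  have hent : ∀ a b, Tendsto (fun k => empTrans (φ (ψ k)) (s (ψ k)) a b) atTop (𝓝 (ν a b)) :=
    fun a b => tendsto_pi_nhds.1 (tendsto_pi_nhds.1 hlim a) b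
  have hgo : Tendsto (fun k => φ (ψ k)) atTop atTop :=
    hφ.tendsto_atTop.comp hψ.tendsto_atTop
  refine ⟨ν, ⟨fun a b => ?_, ?_, fun i => ?_⟩, ?_⟩
  · exact ge_of_tendsto' (hent a b) fun k => empTrans_nonneg _ a b
  · refine tendsto_nhds_unique
      (tendsto_finsetSum _ fun a _ => tendsto_finsetSum _ fun b _ => hent a b) ?_
    refine tendsto_const_nhds.congr fun k => ?_
    have hk := hφ2 (ψ k)
    generalize s (ψ k) = u
    generalize φ (ψ k) = m at *
    obtain ⟨m, rfl⟩ : ∃ m', m = m' + 1 := ⟨m - 1, by lia⟩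
    exact (sum_empTrans_eq_one (by lia) u).symm
  · rw [← sub_eq_zero]
    have h1 := ((tendsto_finsetSum Finset.univ fun j _ => hent i j).sub
      (tendsto_finsetSum Finset.univ fun j _ => hent j i))
    refine tendsto_nhds_unique h1 ?_
    have h2 : Tendsto (fun k => 1 / ((φ (ψ k) - 1 : ℕ) : ℝ)) atTop (𝓝 0) := by
      refine tendsto_const_div_atTop_nhds_zero_nat (1 : ℝ) |>.comp ?_
      exact (tendsto_sub_atTop_nat 1).comp hgo
    refine squeeze_zero_norm (fun k => ?_) h2
    have hk := hφ2 (ψ k)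
    generalize s (ψ k) = u
    generalize φ (ψ k) = m at *
    obtain ⟨m, rfl⟩ : ∃ m', m = m' + 1 := ⟨m - 1, by lia⟩
    exact abs_marginal_empTrans_sub_le u i
  · exact hC.mem_of_tendsto hlim (Eventually.of_forall fun k => hs (ψ k))

variable {ν : S → S → ℝ}

/-- The law of large numbers for the empirical transition distributions of an irreducible chain. By
compactness the divergence is bounded below away from its unique zero, so that the method of types
bounds the probability of a deviation. -/
theorem eventually_sum_seqProb_compl_le (hν : ν ∈ ShiftInvariant S)
    (hirr : (Matrix.of ν).IsIrreducible) {p : S → ℝ} (hp : p ∈ stdSimplex ℝ S)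
    {U : Set (S → S → ℝ)} (hU : IsOpen U) (hνU : ν ∈ U) {c : ℝ} (hc : 0 < c) :
    ∀ᶠ n : ℕ in atTop, ∀ B : Finset (Fin n → S), (∀ s ∈ B, empTrans n s ∉ U) →
      ∑ s ∈ B, seqProb p (Matrix.of (condTrans ν)) n s ≤ c := by
  set Q := Matrix.of (condTrans ν) with hQdef
  have hQ := isIrreducible_condTrans hirr
  have hKc : IsClosed (Uᶜ ∩ {ξ | SupportedOn ξ Q}) := hU.isClosed_compl.inter isClosed_supportedOn
  obtain ⟨a, ha, hK⟩ : ∃ a > 0, ∀ ξ ∈ ShiftInvariant S, ξ ∈ Uᶜ ∩ {ξ | SupportedOn ξ Q} →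
      a < divRate Q ξ := by
    rcases (ShiftInvariant S ∩ (Uᶜ ∩ {ξ | SupportedOn ξ Q})).eq_empty_or_nonempty with he | hne
    · refine ⟨1, one_pos, fun ξ h1 h2 => ?_⟩
      exact (he.subset ⟨h1, h2⟩).elim
    · obtain ⟨ξ, ⟨hξ, hξU, hξQ⟩, hmin⟩ := (ShiftInvariant.isCompact.inter_right hKc).exists_isMinOn
        hne (continuous_divRate (T := Q)).continuousOn
      have hpos : 0 < divRate Q ξ := by
        by_contra! h
        exact hξU (eq_of_divRate_condTrans_nonpos hν hirr hξ hξQ h ▸ hνU)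
      refine ⟨divRate Q ξ / 2, by positivity, fun ζ h1 h2 => ?_⟩
      have : divRate Q ξ ≤ divRate Q ζ := hmin ⟨h1, h2⟩
      linarith
  have hev : ∀ᶠ n : ℕ in atTop, ¬ ∃ s : Fin n → S,
      empTrans n s ∈ (Uᶜ ∩ {ξ | SupportedOn ξ Q}) ∩ {ξ | divRate Q ξ ≤ a} := by
    rw [← not_frequently]
    intro hf
    obtain ⟨ξ, h1, h2, h3⟩ := exists_mem_shiftInvariant_of_frequently
      (hKc.inter (isClosed_le continuous_divRate continuous_const)) hf
    exact (hK ξ h1 h2).not_ge h3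
  filter_upwards [hev, eventually_sum_seqProb_le hp hQ.nonneg (half_lt_self ha),
    eventually_const_le_rpow c⁻¹ (half_pos ha)] with n h1 h2 h3 B hB
  refine (h2 B fun s hs hsupp => ?_).trans ?_
  · by_contra! hlt
    exact h1 ⟨s, ⟨hB s hs, hsupp⟩, hlt.le⟩
  · rw [Real.rpow_neg two_pos.le]
    exact inv_le_of_inv_le₀ hc h3

/-- Change of measure: an event that is likely for the chain with transition distribution `ν` has a
probability under `T` that decays at most at the rate of the divergence of `ν` from `T`. -/
theorem eventually_le_sum_seqProb (hν : ν ∈ ShiftInvariant S)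
    (hirr : (Matrix.of ν).IsIrreducible) {p : S → ℝ} (hp : p ∈ stdSimplex ℝ S)
    {T : Matrix S S ℝ} (hT : ∀ s s', 0 ≤ T s s') (hT1 : ∀ s, ∑ s', T s s' ≤ 1)
    (hsupp : SupportedOn ν T) {a : ℝ} (ha : divRate T ν < a) {c : ℝ} (hc : 0 < c) :
    ∀ᶠ n : ℕ in atTop, ∀ B : Finset (Fin n → S),
      c ≤ ∑ s ∈ B, seqProb p (Matrix.of (condTrans ν)) n s →
      (2 : ℝ) ^ (-(n * a)) ≤ ∑ s ∈ B, seqProb p T n s := by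
  classical
  set Q := Matrix.of (condTrans ν) with hQdef
  have hQ := isIrreducible_condTrans hirr
  obtain ⟨b, hb, hba⟩ := exists_between ha
  have hb0 : 0 ≤ b := (divRate_nonneg hν.1 hT hT1 hsupp).trans hb.le
  -- `G` is linear and agrees with the divergence from `T` at `ν`.
  let G : (S → S → ℝ) → ℝ := fun ξ => (∑ s, ∑ s', ξ s s' * Real.logb 2 (Q s s')) -
      ∑ s, ∑ s', ξ s s' * Real.logb 2 (T s s')
  have hG : Continuous G := by
    simp only [G]; fun_prop
  have hGν : G ν = divRate T ν := by
    rw [divRate_eq_add T Q ν, divRate_condTrans hν.1, zero_add]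
  have hU : IsOpen {ξ | G ξ < b} := isOpen_lt hG continuous_const
  have hlln := eventually_sum_seqProb_compl_le hν hirr hp hU
    (show G ν < b by rw [hGν]; exact hb) (half_pos hc)
  filter_upwards [hlln, eventually_const_le_rpow (c / 2)⁻¹ (sub_pos.2 hba),
    eventually_ge_atTop 1] with n h1 h2 hn B hB
  obtain ⟨n, rfl⟩ : ∃ m, n = m + 1 := ⟨n - 1, by lia⟩
  have hsplit := Finset.sum_filter_add_sum_filter_not B
    (fun s => empTrans (n + 1) s ∈ {ξ | G ξ < b}) (fun s => seqProb p Q (n + 1) s)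
  have hbad := h1 (B.filter fun s => ¬ empTrans (n + 1) s ∈ {ξ | G ξ < b})
    fun s hs => (Finset.mem_filter.1 hs).2
  have hgood : c / 2 ≤ ∑ s ∈ B with empTrans (n + 1) s ∈ {ξ | G ξ < b},
      seqProb p Q (n + 1) s := by linarith
  have hterm : ∀ s ∈ B.filter (fun s => empTrans (n + 1) s ∈ {ξ | G ξ < b}),
      (2 : ℝ) ^ (-((n + 1 : ℕ) * b)) * seqProb p Q (n + 1) s ≤ seqProb p T (n + 1) s := by
    intro s hs
    by_cases hpos : ∀ t : Fin n, 0 < Q (s t.castSucc) (s t.succ)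
    · have hposT : ∀ t : Fin n, 0 < T (s t.castSucc) (s t.succ) := fun t =>
        hsupp.pos hT ((condTrans_eq_zero_iff hν.1).not.1 (hpos t).ne')
      have hGs : G (empTrans (n + 1) s) < b := (Finset.mem_filter.1 hs).2
      simp only [seqProb]
      rw [prod_transition_eq hposT hpos, mul_left_comm]
      refine mul_le_mul_of_nonneg_left (mul_le_mul_of_nonneg_right
        (Real.rpow_le_rpow_of_exponent_le one_le_two (neg_le_neg ?_))
        (Finset.prod_nonneg fun t _ => (hpos t).le)) (hp.1 _)
      calc (n : ℝ) * G (empTrans (n + 1) s) ≤ n * b := by gcongr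
        _ ≤ (n + 1 : ℕ) * b := by gcongr; exact n.le_succ
    · push Not at hpos
      obtain ⟨t, ht⟩ := hpos
      have : seqProb p Q (n + 1) s = 0 := by
        simp only [seqProb]
        rw [Finset.prod_eq_zero (Finset.mem_univ t) (le_antisymm ht (hQ.nonneg _ _)), mul_zero]
      rw [this, mul_zero]
      exact seqProb_nonneg hp.1 hT _ _
  have h3 : (2 : ℝ) ^ (-((n + 1 : ℕ) * (a - b))) ≤ c / 2 := by
    rw [Real.rpow_neg two_pos.le]
    exact inv_le_of_inv_le₀ (half_pos hc) h2
  calc (2 : ℝ) ^ (-((n + 1 : ℕ) * a))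
      = (2 : ℝ) ^ (-((n + 1 : ℕ) * b)) * (2 : ℝ) ^ (-((n + 1 : ℕ) * (a - b))) := by
        rw [← Real.rpow_add two_pos]; congr 1; ring
    _ ≤ (2 : ℝ) ^ (-((n + 1 : ℕ) * b)) * ∑ s ∈ B with empTrans (n + 1) s ∈ {ξ | G ξ < b},
          seqProb p Q (n + 1) s := by
        gcongr
        exact h3.trans hgood
    _ ≤ ∑ s ∈ B with empTrans (n + 1) s ∈ {ξ | G ξ < b}, seqProb p T (n + 1) s := by
        rw [Finset.mul_sum]
        exact Finset.sum_le_sum hterm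
    _ ≤ ∑ s ∈ B, seqProb p T (n + 1) s :=
        Finset.sum_le_sum_of_subset_of_nonneg (Finset.filter_subset _ _)
          fun s _ _ => seqProb_nonneg hp.1 hT _ _

end Asymptotics

/-! ### Exponential rates -/

theorem elog2_mono {x y : ℝ} (h : x ≤ y) : elog2 x ≤ elog2 y := by
  unfold elog2
  split_ifs with hx hy hy
  · exact le_rfl
  · exact bot_le
  · exact absurd (h.trans hy) hx
  · exact EReal.coe_le_coe_iff.2 (Real.logb_le_logb_of_le one_lt_two (not_le.1 hx) h)

theorem elog2_rpow (y : ℝ) : elog2 ((2 : ℝ) ^ y) = (y : EReal) := by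
  rw [elog2, if_neg (Real.rpow_pos_of_pos two_pos y).not_ge, Real.logb_rpow two_pos (by norm_num)]

theorem elog2_rpow_div {n : ℕ} (hn : n ≠ 0) (a : ℝ) :
    elog2 ((2 : ℝ) ^ (-(n * a))) / (n : EReal) = -(a : EReal) := by
  rw [elog2_rpow, ← EReal.coe_coe_eq_natCast, ← EReal.coe_div, ← EReal.coe_neg]
  congr 1
  field_simp

theorem logRate_le {x : ℕ → ℝ} {n : ℕ} (hn : n ≠ 0) {a : ℝ} (h : x n ≤ (2 : ℝ) ^ (-(n * a))) :
    logRate x n ≤ -(a : EReal) := by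
  rw [← elog2_rpow_div hn, logRate]
  exact EReal.div_le_div_right_of_nonneg (Nat.cast_nonneg' n) (elog2_mono h)

theorem le_logRate {x : ℕ → ℝ} {n : ℕ} (hn : n ≠ 0) {a : ℝ} (h : (2 : ℝ) ^ (-(n * a)) ≤ x n) :
    -(a : EReal) ≤ logRate x n := by
  rw [← elog2_rpow_div hn, logRate]
  exact EReal.div_le_div_right_of_nonneg (Nat.cast_nonneg' n) (elog2_mono h)

theorem limsup_logRate_le {x : ℕ → ℝ} {I : EReal}
    (h : ∀ a : ℝ, (a : EReal) < I → ∀ᶠ n : ℕ in atTop, x n ≤ (2 : ℝ) ^ (-(n * a))) :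
    limsup (logRate x) atTop ≤ -I := by
  rw [EReal.le_neg]
  refine EReal.ge_of_forall_gt_iff_ge.1 fun a ha => ?_
  rw [EReal.le_neg]
  refine limsup_le_of_le (by isBoundedDefault) ?_
  filter_upwards [h a ha, eventually_ne_atTop 0] with n hn h0
  exact logRate_le h0 hn

theorem le_liminf_logRate {x : ℕ → ℝ} {I : EReal}
    (h : ∀ a : ℝ, I < (a : EReal) → ∀ᶠ n : ℕ in atTop, (2 : ℝ) ^ (-(n * a)) ≤ x n) :
    -I ≤ liminf (logRate x) atTop := by
  rw [EReal.neg_le]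
  refine EReal.le_of_forall_lt_iff_le.1 fun a ha => ?_
  rw [EReal.neg_le]
  refine le_liminf_of_le (by isBoundedDefault) ?_
  filter_upwards [h a ha, eventually_ne_atTop 0] with n hn h0
  exact le_logRate h0 hn

theorem eventually_le_of_limsup_logRate_le {x : ℕ → ℝ} {η b : ℝ}
    (h : limsup (logRate x) atTop ≤ -(η : EReal)) (hb : b < η) :
    ∀ᶠ n : ℕ in atTop, x n < (2 : ℝ) ^ (-(n * b)) := by
  have h1 : limsup (logRate x) atTop < -(b : EReal) :=
    h.trans_lt (EReal.neg_lt_neg_iff.2 (EReal.coe_lt_coe_iff.2 hb))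
  filter_upwards [eventually_lt_of_limsup_lt h1, eventually_ne_atTop 0] with n hn h0
  by_contra! hle
  exact (le_logRate h0 hle).not_gt hn

/-! ### Perturbation of shift-invariant distributions -/

section Perturbation

theorem isIrreducible_mix {S : Type*} {ν ξ : S → S → ℝ} (hν : ∀ s s', 0 ≤ ν s s')
    (hξ : (Matrix.of ξ).IsIrreducible) {a b : ℝ} (ha : 0 ≤ a) (hb : 0 < b) :
    (Matrix.of (a • ν + b • ξ)).IsIrreducible :=
  hξ.of_pos_imp_pos
    (fun i j => add_nonneg (mul_nonneg ha (hν i j)) (mul_nonneg hb.le (hξ.nonneg i j)))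
    fun i j h => add_pos_of_nonneg_of_pos (mul_nonneg ha (hν i j)) (mul_pos hb h)

variable {S : Type*} [Fintype S]

theorem exists_isIrreducible_mem_shiftInvariant [DecidableEq S] [Nonempty S] {C : Matrix S S ℝ}
    (hC : C.IsIrreducible) :
    ∃ ξ ∈ ShiftInvariant S, (Matrix.of ξ).IsIrreducible ∧ SupportedOn ξ C := by
  let Q : Matrix S S ℝ := Matrix.of (condTrans C)
  have h0 : ∀ i j, 0 ≤ Q i j := condTrans_nonneg hC.nonneg
  have h1 : ∀ i, ∑ j, Q i j = 1 := fun i => sum_condTrans (hC.sum_row_pos i).ne'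
  have hQ : Q.IsIrreducible := isIrreducible_condTrans hC
  obtain ⟨τ, hτ, hs⟩ := exists_stationary h0 h1
  have hpos := hQ.pos_of_mem_stdSimplex hτ hs
  refine ⟨fun s s' => τ s * Q s s', mem_shiftInvariant_of_stationary h0 h1 hτ hs, ?_, ?_⟩
  · exact hQ.of_pos_imp_pos (fun i j => mul_nonneg (hpos i).le (h0 i j))
      fun i j h => mul_pos (hpos i) h
  · intro s s' h
    have : Q s s' = 0 := (condTrans_eq_zero_iff hC.nonneg).2 h
    simp [this]

theorem continuous_divRate_mix (T : Matrix S S ℝ) (ν ξ : S → S → ℝ) :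
    Continuous fun ε : ℝ => divRate T ((1 - ε) • ν + ε • ξ) :=
  continuous_divRate.comp (by fun_prop)

theorem eventually_divRate_mix_lt {T : Matrix S S ℝ} {ν : S → S → ℝ} (ξ : S → S → ℝ) {a : ℝ}
    (h : divRate T ν < a) : ∀ᶠ ε : ℝ in 𝓝[>] 0, divRate T ((1 - ε) • ν + ε • ξ) < a := by
  refine nhdsWithin_le_nhds ?_
  exact ((continuous_divRate_mix T ν ξ).tendsto 0).eventually_lt_const (by simpa using h)

theorem eventually_mem_Ioo_zero_one : ∀ᶠ ε : ℝ in 𝓝[>] 0, ε ∈ Set.Ioo (0 : ℝ) 1 :=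
  Ioo_mem_nhdsGT one_pos

/-- Mixing in a little of an irreducible distribution makes a distribution irreducible and hardly
changes its divergences. -/
theorem exists_isIrreducible_divRate_lt [DecidableEq S] [Nonempty S] {T₀ T₁ : Matrix S S ℝ}
    (hirr : (Matrix.hadamard T₀ T₁).IsIrreducible) {ν : S → S → ℝ} (hν : ν ∈ ShiftInvariant S)
    (h₀ : SupportedOn ν T₀) (h₁ : SupportedOn ν T₁) {η a : ℝ} (hη : divRate T₀ ν < η)
    (ha : divRate T₁ ν < a) :
    ∃ ξ ∈ ShiftInvariant S, (Matrix.of ξ).IsIrreducible ∧ SupportedOn ξ T₀ ∧ SupportedOn ξ T₁ ∧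
      divRate T₀ ξ < η ∧ divRate T₁ ξ < a := by
  obtain ⟨ξ, hξ, hξi, hξs⟩ := exists_isIrreducible_mem_shiftInvariant hirr
  obtain ⟨ε, ⟨⟨hε0, hε1⟩, h1⟩, h2⟩ := ((eventually_mem_Ioo_zero_one.and
    (eventually_divRate_mix_lt ξ hη)).and (eventually_divRate_mix_lt ξ ha)).exists
  refine ⟨(1 - ε) • ν + ε • ξ, ShiftInvariant.convex hν hξ (by linarith) hε0.le (by ring),
    isIrreducible_mix hν.1 hξi (by linarith) hε0, h₀.mix ?_ _ _, h₁.mix ?_ _ _, h1, h2⟩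
  · exact fun s s' h => hξs s s' (by simp [Matrix.hadamard, h])
  · exact fun s s' h => hξs s s' (by simp [Matrix.hadamard, h])

/-- If the strict constraint is feasible, the weak constraint has the same infimum: by convexity,
mixing in a little of a strictly feasible distribution makes the constraint strict. -/
theorem exists_divRate_lt_of_le {T₀ T₁ : Matrix S S ℝ} {ν ξ : S → S → ℝ}
    (hν : ν ∈ ShiftInvariant S) (hξ : ξ ∈ ShiftInvariant S)
    (hν₀ : SupportedOn ν T₀) (hν₁ : SupportedOn ν T₁) (hξ₀ : SupportedOn ξ T₀)
    (hξ₁ : SupportedOn ξ T₁) {η a : ℝ} (hνη : divRate T₀ ν ≤ η) (hξη : divRate T₀ ξ < η)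
    (ha : divRate T₁ ν < a) :
    ∃ ω ∈ ShiftInvariant S, SupportedOn ω T₀ ∧ SupportedOn ω T₁ ∧
      divRate T₀ ω < η ∧ divRate T₁ ω < a := by
  obtain ⟨ε, ⟨hε0, hε1⟩, h⟩ :=
    (eventually_mem_Ioo_zero_one.and (eventually_divRate_mix_lt ξ ha)).exists
  refine ⟨(1 - ε) • ν + ε • ξ, ShiftInvariant.convex hν hξ (by linarith) hε0.le (by ring),
    hν₀.mix hξ₀ _ _, hν₁.mix hξ₁ _ _, ?_, h⟩
  have := divRate_mix_le (T := T₀) hν.1 hξ.1 (a := 1 - ε) (b := ε) (by linarith) hε0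
  nlinarith

end Perturbation

/-! ### Error probabilities of tests -/

section Tests

theorem MDP.sum_induced {S A : Type*} [Fintype S] [Fintype A] (M : MDP S A)
    (π : StationaryPolicy S A) (s : S) :
    ∑ s', M.induced π s s' = 1 := by
  simp only [MDP.induced, Matrix.of_apply]
  rw [Finset.sum_comm]
  simp_rw [← Finset.sum_mul, (M.trans_mem _ _).2, one_mul, (π.prob_mem s).2]

/-- For a likely decision of a test under the chain with transition distribution `ν`, it suffices
that the other decision is unlikely. -/
theorem eventually_half_le_sum_filter {S : Type*} [Fintype S] {p : S → ℝ}
    (hp : p ∈ stdSimplex ℝ S) {Q : Matrix S S ℝ}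
    (hQ1 : ∀ s, ∑ s', Q s s' = 1) {g : SeqTest S} {d : Bool}
    (h : ∀ᶠ n in atTop, ∑ s : Fin n → S with ¬ g n s = d, seqProb p Q n s ≤ 1 / 2) :
    ∀ᶠ n in atTop, 1 / 2 ≤ ∑ s : Fin n → S with g n s = d, seqProb p Q n s := by
  filter_upwards [h, eventually_ne_atTop 0] with n hn h0
  obtain ⟨n, rfl⟩ := Nat.exists_eq_succ_of_ne_zero h0
  have h1 := Finset.sum_filter_add_sum_filter_not Finset.univ (fun s => g (n + 1) s = d)
    (fun s => seqProb p Q (n + 1) s)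
  rw [sum_seqProb_eq hQ1, hp.2] at h1
  simp only [Nat.succ_eq_add_one] at *
  linarith

variable {S A : Type*} [Fintype S] [DecidableEq S] [Fintype A]

theorem decisionProb_eq_sum_filter (M : MDP S A) (π : StationaryPolicy S A) (g : SeqTest S)
    (d : Bool) (n : ℕ) : decisionProb M π g d n =
      ∑ s : Fin n → S with g n s = d, seqProb M.init (M.induced π) n s := by
  rw [decisionProb, Finset.sum_filter]

theorem divTest_eq_false_iff {θ : S → S → ℝ} {T : Matrix S S ℝ}
    (hθ : ∀ s s', condTrans θ s s' = T s s') {η : ℝ} {n : ℕ} {s : Fin n → S} :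
    divTest θ η n s = false ↔ SupportedOn (empTrans n s) T ∧ divRate T (empTrans n s) < η := by
  rw [← divK_lt_coe_iff (empTrans_nonneg s) hθ, divTest]
  split_ifs with h <;> simp [h]

variable {T₀ T₁ : Matrix S S ℝ} {θ₀ : S → S → ℝ} {p : S → ℝ} {η : ℝ}

/-- The chain with transition distribution `ν` is rejected by the divergence test if the divergence
of `ν` is above the threshold. -/
theorem eventually_half_le_sum_reject (hp : p ∈ stdSimplex ℝ S)
    (hθ : ∀ s s', condTrans θ₀ s s' = T₀ s s') {ν : S → S → ℝ} (hν : ν ∈ ShiftInvariant S)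
    (hirr : (Matrix.of ν).IsIrreducible) (h : η < divRate T₀ ν) :
    ∀ᶠ n in atTop, 1 / 2 ≤ ∑ s : Fin n → S with divTest θ₀ η n s = true,
      seqProb p (Matrix.of (condTrans ν)) n s := by
  refine eventually_half_le_sum_filter hp (fun s => sum_condTrans (stateMarginal_pos hirr s).ne') ?_
  filter_upwards [eventually_sum_seqProb_compl_le hν hirr hp
    (isOpen_lt continuous_const (continuous_divRate (T := T₀))) h one_half_pos] with n hn
  refine hn _ fun s hs => ?_
  have := (divTest_eq_false_iff hθ).1 (Bool.eq_false_of_not_eq_true (Finset.mem_filter.1 hs).2)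
  exact not_lt.2 this.2.le

theorem eventually_sum_reject_le (hp : p ∈ stdSimplex ℝ S) (hT₀ : ∀ s s', 0 ≤ T₀ s s')
    (hθ : ∀ s s', condTrans θ₀ s s' = T₀ s s') {b : ℝ} (hb : b < η) :
    ∀ᶠ n : ℕ in atTop, ∑ s : Fin n → S with divTest θ₀ η n s = true, seqProb p T₀ n s ≤
      (2 : ℝ) ^ (-(n * b)) := by
  filter_upwards [eventually_sum_seqProb_le hp hT₀ hb] with n hn
  refine hn _ fun s hs hsupp => ?_
  by_contra! hlt
  have := (divTest_eq_false_iff hθ).2 ⟨hsupp, hlt⟩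
  simp [this] at hs

/-- If the divergence from `T₁` exceeds `a` on all shift-invariant distributions whose divergence
from `T₀` is at most `η`, then the divergence test accepts the chain of `T₁` with a probability that
decays at least at the rate `a`. -/
theorem eventually_sum_accept_le (hp : p ∈ stdSimplex ℝ S) (hT₁ : ∀ s s', 0 ≤ T₁ s s')
    (hθ : ∀ s s', condTrans θ₀ s s' = T₀ s s') {a b : ℝ} (hb : b < a)
    (h : ∀ ν ∈ ShiftInvariant S, SupportedOn ν T₀ → SupportedOn ν T₁ → divRate T₀ ν ≤ η →
      a < divRate T₁ ν) :
    ∀ᶠ n : ℕ in atTop, ∑ s : Fin n → S with divTest θ₀ η n s = false, seqProb p T₁ n s ≤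
      (2 : ℝ) ^ (-(n * b)) := by
  have hev : ∀ᶠ n : ℕ in atTop, ¬ ∃ s : Fin n → S, empTrans n s ∈
      ({ν | SupportedOn ν T₀} ∩ {ν | SupportedOn ν T₁}) ∩
        ({ν | divRate T₀ ν ≤ η} ∩ {ν | divRate T₁ ν ≤ a}) := by
    rw [← not_frequently]
    intro hf
    obtain ⟨ν, hν, ⟨h0, h1⟩, h2, h3⟩ := exists_mem_shiftInvariant_of_frequently
      ((isClosed_supportedOn.inter isClosed_supportedOn).inter
        ((isClosed_le continuous_divRate continuous_const).inter
          (isClosed_le continuous_divRate continuous_const))) hf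
    exact (h ν hν h0 h1 h2).not_ge h3
  filter_upwards [hev, eventually_sum_seqProb_le hp hT₁ hb] with n h1 h2
  refine h2 _ fun s hs hsupp => ?_
  by_contra! hlt
  obtain ⟨h3, h4⟩ := (divTest_eq_false_iff hθ).1 (Finset.mem_filter.1 hs).2
  exact h1 ⟨s, ⟨h3, hsupp⟩, h4.le, hlt.le⟩

/-- A test that meets the type I constraint rarely rejects a chain with divergence below the
threshold: otherwise, by the change of measure, it would reject the null hypothesis too often. -/
theorem eventually_half_le_sum_of_typeI (hp : p ∈ stdSimplex ℝ S) (hT₀ : ∀ s s', 0 ≤ T₀ s s')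
    (hT₀1 : ∀ s, ∑ s', T₀ s s' ≤ 1) {ν : S → S → ℝ} (hν : ν ∈ ShiftInvariant S)
    (hirr : (Matrix.of ν).IsIrreducible) (hs : SupportedOn ν T₀) (h : divRate T₀ ν < η)
    {g : SeqTest S} (hg : ∀ b < η, ∀ᶠ n : ℕ in atTop,
      ∑ s : Fin n → S with g n s = true, seqProb p T₀ n s < (2 : ℝ) ^ (-(n * b))) :
    ∀ᶠ n in atTop, 1 / 2 ≤ ∑ s : Fin n → S with g n s = false,
      seqProb p (Matrix.of (condTrans ν)) n s := by
  obtain ⟨b, hb, hbη⟩ := exists_between h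
  refine eventually_half_le_sum_filter hp (fun s => sum_condTrans (stateMarginal_pos hirr s).ne') ?_
  filter_upwards [hg b hbη,
    eventually_le_sum_seqProb hν hirr hp hT₀ hT₀1 hs hb one_half_pos] with n h1 h2
  by_contra! hlt
  simp only [Bool.not_eq_false] at hlt
  exact (h2 _ hlt.le).not_gt h1

end Tests

end

theorem theorem5 {S A : Type*} [Fintype S] [DecidableEq S] [Fintype A] (M : MDP S A)
    (hM : M.IsRecurrent) (π₀ : StationaryPolicy S A) (θ₀ : S → S → ℝ)
    (hθ₀ : IsTransitionFreq (M.induced π₀) θ₀) (η : ℝ) (hη : 0 < η) :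
    IsOptimalTest M π₀
        {π₁ | ∃ θ₁, IsTransitionFreq (M.induced π₁) θ₁ ∧
          NondegenerateAlternative M π₀ π₁ θ₀ θ₁ η}
        η (divTest θ₀ η) ∧
    ((∃ ν ∈ ShiftInvariant S, (η : EReal) < divK ν θ₀ ∧ divK ν θ₀ < ⊤) →
      Tendsto (logRate (typeIError M π₀ (divTest θ₀ η))) atTop (𝓝 (-(η : EReal)))) ∧
    (∀ (π₁ : StationaryPolicy S A) (θ₁ : S → S → ℝ), IsTransitionFreq (M.induced π₁) θ₁ →
      NondegenerateAlternative M π₀ π₁ θ₀ θ₁ η →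
      Tendsto (logRate (typeIIError M π₁ (divTest θ₀ η))) atTop
        (𝓝 (-⨅ ν ∈ {ν ∈ ShiftInvariant S | divK ν θ₀ < (η : EReal)}, divK ν θ₁))) := by
  have hS : Nonempty S := by
    by_contra h
    rw [not_nonempty_iff] at h
    simpa using M.init_mem.2
  have hp := M.init_mem
  have hst1 := fun π => M.sum_induced π
  have hcond : ∀ π θ, IsTransitionFreq (M.induced π) θ →
      ∀ s s', condTrans θ s s' = M.induced π s s' := fun π θ h =>
    condTrans_of_isTransitionFreq (hM π) (hst1 π) h
  have hc₀ := hcond π₀ θ₀ hθ₀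
  have hupI : limsup (logRate (typeIError M π₀ (divTest θ₀ η))) atTop ≤ -(η : EReal) := by
    refine limsup_logRate_le fun b hb => ?_
    simp only [typeIError, decisionProb_eq_sum_filter]
    exact eventually_sum_reject_le hp (hM π₀).nonneg hc₀ (EReal.coe_lt_coe_iff.1 hb)
  -- Below every rate larger than the infimum there is an irreducible feasible distribution.
  have hfeas : ∀ π₁ θ₁, IsTransitionFreq (M.induced π₁) θ₁ →
      NondegenerateAlternative M π₀ π₁ θ₀ θ₁ η → ∀ a : ℝ,
      (⨅ ν ∈ {ν ∈ ShiftInvariant S | divK ν θ₀ < (η : EReal)}, divK ν θ₁) < (a : EReal) →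
      ∃ ξ ∈ ShiftInvariant S, (Matrix.of ξ).IsIrreducible ∧ SupportedOn ξ (M.induced π₀) ∧
        SupportedOn ξ (M.induced π₁) ∧ divRate (M.induced π₀) ξ < η ∧
        divRate (M.induced π₁) ξ < a := by
    intro π₁ θ₁ hθ₁ hnd a ha
    simp only [iInf_lt_iff] at ha
    obtain ⟨ν, ⟨hν, hνη⟩, hνa⟩ := ha
    rcases hnd with hnd | ⟨-, hirr⟩
    · exact absurd (hnd ν hν (hνa.trans (EReal.coe_lt_top a))) hνη.not_gt
    · rw [divK_lt_coe_iff hν.1 hc₀] at hνη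
      rw [divK_lt_coe_iff hν.1 (hcond π₁ θ₁ hθ₁)] at hνa
      exact exists_isIrreducible_divRate_lt hirr hν hνη.1 hνa.1 hνη.2 hνa.2
  have hlow : ∀ π₁ θ₁, IsTransitionFreq (M.induced π₁) θ₁ →
      NondegenerateAlternative M π₀ π₁ θ₀ θ₁ η → ∀ g : SeqTest S, TypeIConstraint M π₀ η g →
      -(⨅ ν ∈ {ν ∈ ShiftInvariant S | divK ν θ₀ < (η : EReal)}, divK ν θ₁) ≤
        liminf (logRate (typeIIError M π₁ g)) atTop := by
    intro π₁ θ₁ hθ₁ hnd g hg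
    refine le_liminf_logRate fun a ha => ?_
    obtain ⟨ξ, hξ, hirr, hs₀, hs₁, hd₀, hd₁⟩ := hfeas π₁ θ₁ hθ₁ hnd a ha
    simp only [typeIIError, decisionProb_eq_sum_filter]
    have hg' : ∀ b < η, ∀ᶠ n : ℕ in atTop, ∑ s : Fin n → S with g n s = true,
        seqProb M.init (M.induced π₀) n s < (2 : ℝ) ^ (-(n * b)) := fun b hb => by
      have := eventually_le_of_limsup_logRate_le hg hb
      simpa only [typeIError, decisionProb_eq_sum_filter] using this
    filter_upwards [eventually_half_le_sum_of_typeI hp (hM π₀).nonneg (fun s => (hst1 π₀ s).le)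
        hξ hirr hs₀ hd₀ hg',
      eventually_le_sum_seqProb hξ hirr hp (hM π₁).nonneg (fun s => (hst1 π₁ s).le) hs₁ hd₁
        one_half_pos] with n h1 h2
    exact h2 _ h1
  have hupII : ∀ π₁ θ₁, IsTransitionFreq (M.induced π₁) θ₁ →
      NondegenerateAlternative M π₀ π₁ θ₀ θ₁ η →
      limsup (logRate (typeIIError M π₁ (divTest θ₀ η))) atTop ≤
        -(⨅ ν ∈ {ν ∈ ShiftInvariant S | divK ν θ₀ < (η : EReal)}, divK ν θ₁) := by
    intro π₁ θ₁ hθ₁ hnd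
    have hc₁ := hcond π₁ θ₁ hθ₁
    refine limsup_logRate_le fun b hb => ?_
    obtain ⟨a', hba', ha'⟩ := EReal.lt_iff_exists_real_btwn.1 hb
    obtain ⟨a, hba, haa'⟩ := exists_between (EReal.coe_lt_coe_iff.1 hba')
    simp only [typeIIError, decisionProb_eq_sum_filter]
    refine eventually_sum_accept_le hp (hM π₁).nonneg hc₀ hba fun ν hν h₀ h₁ hνη => ?_
    by_contra! hle
    rcases hnd with hnd | ⟨⟨ξ, hξ, hξη, hξt⟩, -⟩
    · have := hnd ν hν ((divK_lt_top_iff hν.1 hc₁).2 h₁)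
      rw [(divK_eq hν.1 hc₀).1 h₀, EReal.coe_lt_coe_iff] at this
      exact this.not_ge hνη
    · rw [divK_lt_coe_iff hξ.1 hc₀] at hξη
      obtain ⟨ω, hω, hω₀, hω₁, hωη, hωa⟩ := exists_divRate_lt_of_le hν hξ h₀ h₁ hξη.1
        ((divK_lt_top_iff hξ.1 hc₁).1 hξt) hνη hξη.2 (hle.trans_lt haa')
      have h1 := (iInf₂_le (f := fun ν (_ : ν ∈ {ν ∈ ShiftInvariant S | divK ν θ₀ < (η : EReal)}) =>
        divK ν θ₁) ω ⟨hω, (divK_lt_coe_iff hω.1 hc₀).2 ⟨hω₀, hωη⟩⟩)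
      exact (ha'.trans_le h1).not_gt ((divK_lt_coe_iff hω.1 hc₁).2 ⟨hω₁, hωa⟩)
  refine ⟨⟨hupI, ?_⟩, ?_, ?_⟩
  · rintro g hg π₁ ⟨θ₁, hθ₁, hnd⟩
    rw [EReal.neg_le_neg_iff]
    exact (hupII π₁ θ₁ hθ₁ hnd).trans ((hlow π₁ θ₁ hθ₁ hnd g hg).trans liminf_le_limsup)
  · rintro ⟨ν, hν, hνη, hνt⟩
    have hs := (divK_lt_top_iff hν.1 hc₀).1 hνt
    rw [(divK_eq hν.1 hc₀).1 hs, EReal.coe_lt_coe_iff] at hνη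
    refine tendsto_of_le_liminf_of_limsup_le (le_liminf_logRate fun a ha => ?_) hupI
    obtain ⟨τ, hτ, hst, hθ⟩ := hθ₀
    have hpos := (hM π₀).pos_of_mem_stdSimplex hτ hst
    have hθe : θ₀ = fun s s' => τ s * M.induced π₀ s s' := by ext s s'; exact hθ s s'
    have hθM : θ₀ ∈ ShiftInvariant S := hθe ▸
      mem_shiftInvariant_of_stationary (hM π₀).nonneg (hst1 π₀) hτ hst
    have hθi : (Matrix.of θ₀).IsIrreducible := (hM π₀).of_pos_imp_pos hθM.1 fun s s' h => by
      rw [Matrix.of_apply, hθ]; exact mul_pos (hpos s) h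
    have hθs : SupportedOn θ₀ (M.induced π₀) := fun s s' h => by rw [hθ, h, mul_zero]
    have hθ0 : divRate (M.induced π₀) θ₀ = 0 := by
      have : Matrix.of (condTrans θ₀) = M.induced π₀ := by ext s s'; exact hc₀ s s'
      rw [← this, divRate_condTrans hθM.1]
    obtain ⟨c, hηc, hc⟩ := exists_between (lt_min (EReal.coe_lt_coe_iff.1 ha) hνη)
    rw [lt_min_iff] at hc
    -- The divergence takes the value `c` on the segment from `ν` to the stationary distribution.
    obtain ⟨ε, ⟨hε0, hε1⟩, hε⟩ := intermediate_value_Icc' zero_le_one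
      (continuous_divRate_mix (M.induced π₀) ν θ₀).continuousOn
      (show c ∈ Set.Icc _ _ by
        simp only [sub_self, zero_smul, one_smul, zero_add, sub_zero, add_zero, hθ0]
        exact ⟨by linarith, hc.2.le⟩)
    have hε0' : 0 < ε := by
      refine lt_of_le_of_ne hε0 fun h => hc.2.ne' ?_
      rw [← hε, ← h]; simp
    have hωM := ShiftInvariant.convex hν hθM (a := 1 - ε) (by linarith) hε0 (by ring)
    have hωi := isIrreducible_mix hν.1 hθi (a := 1 - ε) (by linarith) hε0'
    simp only [typeIError, decisionProb_eq_sum_filter]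
    filter_upwards [eventually_half_le_sum_reject hp hc₀ hωM hωi (hηc.trans_eq hε.symm),
      eventually_le_sum_seqProb hωM hωi hp (hM π₀).nonneg (fun s => (hst1 π₀ s).le)
        (hs.mix hθs _ _) (hε.trans_lt hc.1) one_half_pos] with n h1 h2
    exact h2 _ h1
  · intro π₁ θ₁ hθ₁ hnd
    exact tendsto_of_le_liminf_of_limsup_le (hlow π₁ θ₁ hθ₁ hnd _ hupI) (hupII π₁ θ₁ hθ₁ hnd)
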